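/- **Example 3.10.** Let $I(\mathbb R^3)=O(3)\ltimes\mathbb R^3$ be the isometry group of Euclidean $\mathbb R^3$ (with the compact-open topology), let $L_b$ be the translation $x\mapsto x+b$, let $\Lambda=2\mathbb Z\times2\mathbb Z\times2\mathbb Z$, and let $T_\Lambda=\mathbb R^3/\Lambda$ be the flat torus. Let $$\chi_1=\operatorname{diag}(-1,1,1),\quad \chi_2=\operatorname{diag}(-1,-1,1),\quad \chi_3=\operatorname{diag}(1,-1,1),$$ $$b_1=b_3=e_1+e_2,\quad b_2=0,\qquad b_1'=b_3'=e_3,\quad b_2'=0,$$ $\rho_j=\chi_j\circ L_{b_j}$, $\rho_j'=\chi_j\circ L_{b_j'}$ for $j=1,2,3$, $\rho_0=\rho_0'=\mathrm{Id}$, and $$\Gamma_1=\{\rho_jL_\lambda : 0\le j\le 3,\ \lambda\in\Lambda\},\qquad \Gamma_2=\{\rho_j'L_\lambda : 0\le j\le 3,\ \lambda\in\Lambda\}.$$ 1. $\Gamma_1$ and $\Gamma_2$ are discrete and cocompact subgroups of $I(\mathbb R^3)$. The flat orbifolds $\mathcal O_i=\Gamma_i\backslash\mathbb R^3$ ($i=1,2$)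 are not orientable. The box $[0,1]\times[0,1]\times[0,2]$ is a fundamental domain for both groups (its translates cover $\mathbb R^3$, and the translates of its interior by different elements are disjoint), and the underlying topological space of $\mathcal O_1$ is homeomorphic to $\mathbb RP^2\times S^1$. 2. The elements of $\Gamma_1$, $\Gamma_2$ and the maps $BL_b$, where $B$ is a permutation matrix and $b\in\frac14\Lambda$, descend to isometries of $T_\Lambda$. The groups of isometries of $T_\Lambda$ induced by $\Gamma_1$ and $\Gamma_2$ are $\bar\Gamma_1=\{\overline{\rho_j} : 0\le j\le3\}$ and $\bar\Gamma_2=\{\overline{\rho_j'} : 0\le j\le 3\}$, and $\mathcal O_i$ is isometric to $\bar\Gamma_i\backslash T_\Lambda$ for $i=1,2$. Let $G$ be the group generated by $\bar\Gamma_1$, $\bar\Gamma_2$ and all $\overline{BL_b}$ as above. Then $G$ is finite, and $\bar\Gamma_1$ and $\bar\Gamma_2$ are almost conjugate in $G$: each conjugacy class of $G$ meets both of them in the same number of elements. Hence $\mathcal O_1$ and $\mathcal O_2$ are Sunada-isospectral; in particular, for each $\mu\in\mathbb R$ the spaces of $\Gamma_i$-invariant smooth functions $f:\mathbb R^3\to\mathbb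 R$ with $-\sum_j\partial_j^2f=\mu f$ are finite-dimensional and have the same dimension for $i=1,2$. 3. $\mathcal O_1$ and $\mathcal O_2$ are not isometric as Riemannian orbifolds. For both $i$, the set of points of $\mathbb R^3$ fixed by some nontrivial element of $\Gamma_i$ is $\mathbb Z\times\mathbb Z\times\mathbb R$; each of these points is fixed by exactly one nontrivial element of $\Gamma_i$, and so its isotropy group is $\cong\mathbb Z_2$. The singular set (the set of points with nontrivial isotropy) of $\mathcal O_1$ is the disjoint union of two circles of length two, and that of $\mathcal O_2$ is the disjoint union of four circles of length one; so these singular sets have $2$ and $4$ connected components, respectively. -/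

import Mathlib

open scoped ContDiff

noncomputable section

namespace FlatOrbifold

/-! ### Good Riemannian orbifolds `Γ \ M`, for a group `Γ` of isometries of `M` -/

section General

variable {M N : Type*} [PseudoMetricSpace M] [PseudoMetricSpace N]

/-- The isometry group of `M` acts on `M` by evaluation. -/
instance isometryAction : MulAction (M ≃ᵢ M) M where
  smul g x := g x
  one_smul _ := rfl
  mul_smul _ _ _ := rfl

/-- The compact-open topology on the isometry group. -/
instance isometryGroupTopology : TopologicalSpace (M ≃ᵢ M) :=
  TopologicalSpace.induced
    (fun g => (⟨g, g.continuous⟩ : ContinuousMap M M)) inferInstance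

/-- The underlying space of `Γ \ M`, with the quotient topology. -/
abbrev OrbitSpace (Γ : Subgroup (M ≃ᵢ M)) : Type _ :=
  Quotient (MulAction.orbitRel Γ M)

/-- The canonical projection `M → Γ \ M`. -/
def proj (Γ : Subgroup (M ≃ᵢ M)) (x : M) : OrbitSpace Γ :=
  Quotient.mk (MulAction.orbitRel Γ M) x

/-- The quotient distance: the infimum of the distances between representatives. -/
def orbitDist (Γ : Subgroup (M ≃ᵢ M)) (p q : OrbitSpace Γ) : ℝ :=
  sInf {r : ℝ | ∃ x y : M, proj Γ x = p ∧ proj Γ y = q ∧ r = dist x y}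

/-- The isotropy group of the image of `x` in `Γ \ M`. -/
abbrev isotropy (Γ : Subgroup (M ≃ᵢ M)) (x : M) : Subgroup Γ :=
  MulAction.stabilizer Γ x

/-- The singular set of `Γ \ M`: the image of the points with nontrivial stabilizer. -/
def singularSet (Γ : Subgroup (M ≃ᵢ M)) : Set (OrbitSpace Γ) :=
  {p | ∃ x : M, proj Γ x = p ∧ isotropy Γ x ≠ ⊥}

/-- `Γ \ M` and `Γ' \ N` are isometric as Riemannian orbifolds: there is a homeomorphism of the
underlying spaces which near every point lifts to an isometry from an open subset of `M` onto an
open subset of `N`. -/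
def OrbifoldIsometric (Γ : Subgroup (M ≃ᵢ M)) (Γ' : Subgroup (N ≃ᵢ N)) : Prop :=
  ∃ f : OrbitSpace Γ ≃ₜ OrbitSpace Γ', ∀ x : M, ∃ φ : OpenPartialHomeomorph M N,
    x ∈ φ.source ∧
    (∀ y ∈ φ.source, ∀ z ∈ φ.source, dist (φ y) (φ z) = dist y z) ∧
    ∀ y ∈ φ.source, f (proj Γ y) = proj Γ' (φ y)

/-- The subset `S` of `Γ \ M` is the disjoint union of `n` circles of length `ℓ`: it is homeomorphic
to the disjoint union of `n` copies of `ℝ / ℓℤ` in such a way that each copy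
is mapped locally isometrically. -/
def IsDisjointUnionOfCircles (Γ : Subgroup (M ≃ᵢ M)) (S : Set (OrbitSpace Γ)) (n : ℕ) (ℓ : ℝ) :
    Prop :=
  ∃ e : (Fin n × AddCircle ℓ) ≃ₜ S, ∀ (i : Fin n) (s : AddCircle ℓ), ∃ U ∈ nhds s,
    ∀ t ∈ U, ∀ t' ∈ U, orbitDist Γ (e (i, t) : OrbitSpace Γ) (e (i, t')) = dist t t'

/-- `D` is a (closed) fundamental domain for `Γ`: its translates cover `M`, and the interiors of
the translates by different elements are disjoint. -/
def IsClosedFundamentalDomain (Γ : Subgroup (M ≃ᵢ M)) (D : Set M) : Prop :=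
  IsClosed D ∧ (∀ x : M, ∃ g ∈ Γ, g x ∈ D) ∧
    ∀ g ∈ Γ, g ≠ 1 → Disjoint (g '' interior D) (interior D)

/-- A discrete and cocompact group of isometries. -/
def IsCrystallographic (Γ : Subgroup (M ≃ᵢ M)) : Prop :=
  DiscreteTopology Γ ∧ CompactSpace ((M ≃ᵢ M) ⧸ Γ)

end General

/-- Two finite subgroups of `G` are almost conjugate in `G` if each conjugacy class of `G` meets them
in the same number of elements. -/
def AlmostConjugate {G : Type*} [Group G] (H₁ H₂ : Subgroup G) : Prop :=
  Finite H₁ ∧ Finite H₂ ∧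
    ∀ b : G, (conjugatesOf b ∩ (H₁ : Set G)).ncard = (conjugatesOf b ∩ (H₂ : Set G)).ncard

/-! ### Flat orbifolds `Γ \ ℝⁿ` -/

/-- Euclidean space `ℝⁿ`. -/
abbrev E (n : ℕ) : Type := EuclideanSpace ℝ (Fin n)

/-- The translation `L_b : x ↦ x + b`. -/
def transl {n : ℕ} (b : E n) : E n ≃ᵢ E n := IsometryEquiv.addRight b

theorem isometry_mulVec {n : ℕ} (B : Matrix.orthogonalGroup (Fin n) ℝ) :
    Isometry (fun x : E n => (WithLp.toLp 2 (B.1.mulVec x.ofLp) : E n)) := by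
  refine Isometry.of_dist_eq fun x y => ?_
  have h : B.1.transpose * B.1 = 1 := by
    have := (Matrix.mem_orthogonalGroup_iff' (Fin n) ℝ).1 B.2
    simpa [Matrix.star_eq_conjTranspose] using this
  rw [dist_eq_norm, dist_eq_norm]
  have key : ∀ z : E n, ‖(WithLp.toLp 2 (B.1.mulVec z.ofLp) : E n)‖ ^ 2 = ‖z‖ ^ 2 := by
    intro z
    rw [← real_inner_self_eq_norm_sq, ← real_inner_self_eq_norm_sq]
    simp only [EuclideanSpace.inner_eq_star_dotProduct, star_trivial]
    rw [Matrix.dotProduct_mulVec, ← Matrix.mulVec_transpose, Matrix.mulVec_mulVec, h,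
      Matrix.one_mulVec]
  have := key (x - y)
  rw [sq_eq_sq₀ (norm_nonneg _) (norm_nonneg _)] at this
  rw [← this, ← WithLp.toLp_sub, ← Matrix.mulVec_sub, WithLp.ofLp_sub]

/-- The linear isometry `x ↦ B x` for `B ∈ O(n)`. -/
def ortho {n : ℕ} (B : Matrix.orthogonalGroup (Fin n) ℝ) : E n ≃ᵢ E n :=
  IsometryEquiv.mk' (fun x => WithLp.toLp 2 (B.1.mulVec x.ofLp))
    (fun x => WithLp.toLp 2 ((B⁻¹).1.mulVec x.ofLp))
    (fun x => by
      have h : B.1 * (B⁻¹).1 = 1 := congrArg Subtype.val (mul_inv_cancel B)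
      simp only [Matrix.mulVec_mulVec, h, Matrix.one_mulVec])
    (isometry_mulVec B)

/-- `Γ \ ℝⁿ` is orientable: there is a continuous (that is, locally constant) choice of orientations
of the tangent spaces of `ℝⁿ` which is invariant under the differentials of the elements of `Γ`. -/
def Orientable {n : ℕ} (Γ : Subgroup (E n ≃ᵢ E n)) : Prop :=
  ∃ o : E n → Orientation ℝ (E n) (Fin n), IsLocallyConstant o ∧
    ∀ g ∈ Γ, ∀ x : E n,
      Orientation.map (Fin n) g.toRealAffineIsometryEquiv.linearIsometryEquiv.toLinearEquiv (o x) =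
        o (g x)

/-- The `μ`-eigenspace of the (positive) Laplace operator on the space `C^∞(Γ \ ℝⁿ) = C^∞(ℝⁿ)^Γ` of
smooth functions on `Γ \ ℝⁿ`. -/
def eigenspace {n : ℕ} (Γ : Subgroup (E n ≃ᵢ E n)) (μ : ℝ) : Submodule ℝ (E n → ℝ) where
  carrier := {f | ContDiff ℝ ∞ f ∧ (∀ g ∈ Γ, ∀ x, f (g x) = f x) ∧
    ∀ x, -(Laplacian.laplacian f x) = μ * f x}
  zero_mem' := by
    refine ⟨contDiff_const, fun _ _ _ => rfl, fun x => ?_⟩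
    have h : Laplacian.laplacian (0 : E n → ℝ) = 0 :=
      InnerProductSpace.laplacian_const (E := E n) (c := (0 : ℝ))
    rw [h]
    simp
  add_mem' := by
    rintro f h ⟨hf, hf', hf''⟩ ⟨hh, hh', hh''⟩
    refine ⟨hf.add hh, fun g hg x => ?_, fun x => ?_⟩
    · simp only [Pi.add_apply, hf' g hg, hh' g hg]
    · have h1 : ContDiffAt ℝ 2 f x := (hf.of_le (by exact WithTop.coe_le_coe.2 le_top)).contDiffAt
      have h2 : ContDiffAt ℝ 2 h x := (hh.of_le (by exact WithTop.coe_le_coe.2 le_top)).contDiffAt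
      rw [h1.laplacian_add h2, neg_add, hf'', hh'', Pi.add_apply, mul_add]
  smul_mem' := by
    rintro c f ⟨hf, hf', hf''⟩
    refine ⟨contDiff_const.smul hf, fun g hg x => ?_, fun x => ?_⟩
    · simp only [Pi.smul_apply, hf' g hg]
    · have h1 : ContDiffAt ℝ 2 f x := (hf.of_le (by exact WithTop.coe_le_coe.2 le_top)).contDiffAt
      rw [InnerProductSpace.laplacian_smul c h1, smul_eq_mul, ← mul_neg, hf'', Pi.smul_apply,
        smul_eq_mul]
      ring

/-- `Γ₁ \ ℝⁿ` and `Γ₂ \ ℝⁿ` have the same Laplace spectrum on functions: every number is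
an eigenvalue of the same finite multiplicity (possibly zero) for both. -/
def Isospectral {n : ℕ} (Γ₁ Γ₂ : Subgroup (E n ≃ᵢ E n)) : Prop :=
  ∀ μ : ℝ, FiniteDimensional ℝ (eigenspace Γ₁ μ) ∧ FiniteDimensional ℝ (eigenspace Γ₂ μ) ∧
    Module.finrank ℝ (eigenspace Γ₁ μ) = Module.finrank ℝ (eigenspace Γ₂ μ)

/-! ### The flat torus `T_Λ = ℝⁿ / Λ` -/

/-- The flat torus, with the quotient metric. -/
abbrev Torus {n : ℕ} (Λ : AddSubgroup (E n)) : Type := E n ⧸ Λ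

/-- `h` is the map of the torus induced by `g`. -/
def Induces {n : ℕ} {Λ : AddSubgroup (E n)} (g : E n ≃ᵢ E n) (h : Torus Λ ≃ᵢ Torus Λ) : Prop :=
  ∀ x : E n, h (QuotientAddGroup.mk x) = QuotientAddGroup.mk (g x)

/-- The group of all isometries of the torus which are induced by elements of `Γ`. -/
def inducedGroup {n : ℕ} (Λ : AddSubgroup (E n)) (Γ : Subgroup (E n ≃ᵢ E n)) :
    Subgroup (Torus Λ ≃ᵢ Torus Λ) where
  carrier := {h | ∃ g ∈ Γ, Induces g h}
  one_mem' := ⟨1, Γ.one_mem, fun _ => rfl⟩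
  mul_mem' := by
    rintro h k ⟨g, hg, hgh⟩ ⟨l, hl, hlk⟩
    refine ⟨g * l, Γ.mul_mem hg hl, fun x => ?_⟩
    rw [IsometryEquiv.mul_apply, hlk, hgh, IsometryEquiv.mul_apply]
  inv_mem' := by
    rintro h ⟨g, hg, hgh⟩
    refine ⟨g⁻¹, Γ.inv_mem hg, fun x => ?_⟩
    apply h.injective
    rw [IsometryEquiv.apply_inv_self, hgh, IsometryEquiv.apply_inv_self]

/-- The flat orbifolds `Γ₁ \ ℝⁿ` and `Γ₂ \ ℝⁿ` are Sunada-isospectral by means of the group `G`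
of isometries of the torus and its subgroups `H₁`, `H₂`: these are finite and almost conjugate
in `G`, their quotients of the torus are the two orbifolds, and the orbifolds are isospectral. -/
structure SunadaIsospectralVia {n : ℕ} {Λ : AddSubgroup (E n)}
    (G H₁ H₂ : Subgroup (Torus Λ ≃ᵢ Torus Λ)) (Γ₁ Γ₂ : Subgroup (E n ≃ᵢ E n)) : Prop where
  le₁ : H₁ ≤ G
  le₂ : H₂ ≤ G
  almostConjugate : AlmostConjugate (H₁.subgroupOf G) (H₂.subgroupOf G)
  quotient₁ : OrbifoldIsometric Γ₁ H₁
  quotient₂ : OrbifoldIsometric Γ₂ H₂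
  isospectral : Isospectral Γ₁ Γ₂

/-! ### The two orbifolds -/

/-- The lattice `Λ = 2ℤ × 2ℤ × 2ℤ`. -/
def Lam : AddSubgroup (E 3) where
  carrier := {v | ∀ i, ∃ m : ℤ, v i = 2 * m}
  zero_mem' := fun _ => ⟨0, by simp⟩
  add_mem' := by
    intro a b ha hb i
    obtain ⟨m, hm⟩ := ha i
    obtain ⟨k, hk⟩ := hb i
    exact ⟨m + k, by simp [hm, hk, mul_add]⟩
  neg_mem' := by
    intro a ha i
    obtain ⟨m, hm⟩ := ha i
    exact ⟨-m, by simp [hm]⟩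

theorem diagonal_mem (s : Fin 3 → ℝ) (hs : ∀ i, s i * s i = 1) :
    Matrix.diagonal s ∈ Matrix.orthogonalGroup (Fin 3) ℝ := by
  rw [Matrix.mem_orthogonalGroup_iff, Matrix.diagonal_transpose, Matrix.diagonal_mul_diagonal, ← Matrix.diagonal_one]
  congr 1
  funext i
  exact hs i

/-- The linear parts: `χ₀ = Id`, `χ₁ = diag(-1,1,1)`, `χ₂ = diag(-1,-1,1)`, `χ₃ = diag(1,-1,1)`. -/
def chi : Fin 4 → Matrix.orthogonalGroup (Fin 3) ℝ :=
  ![1,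
    ⟨Matrix.diagonal ![-1, 1, 1], diagonal_mem _ (by simp [Fin.forall_fin_succ])⟩,
    ⟨Matrix.diagonal ![-1, -1, 1], diagonal_mem _ (by simp [Fin.forall_fin_succ])⟩,
    ⟨Matrix.diagonal ![1, -1, 1], diagonal_mem _ (by simp [Fin.forall_fin_succ])⟩]

/-- The translational parts for the first group: `0, e₁ + e₂, 0, e₁ + e₂`. -/
def trans₁ : Fin 4 → E 3 := ![0, !₂[1, 1, 0], 0, !₂[1, 1, 0]]

/-- The translational parts for the second group: `0, e₃, 0, e₃`. -/
def trans₂ : Fin 4 → E 3 := ![0, !₂[0, 0, 1], 0, !₂[0, 0, 1]]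

/-- The isometries `ρ_j = χ_j ∘ L_{b_j}`. -/
def rho (b : Fin 4 → E 3) (j : Fin 4) : E 3 ≃ᵢ E 3 := ortho (chi j) * transl (b j)

/-- The set `{ρ_j L_λ | j ∈ {0,1,2,3}, λ ∈ Λ}`. -/
def rhoSet (b : Fin 4 → E 3) : Set (E 3 ≃ᵢ E 3) :=
  {g | ∃ j : Fin 4, ∃ v ∈ Lam, g = rho b j * transl v}

/-- The group `Γ₁`. -/
def Gam₁ : Subgroup (E 3 ≃ᵢ E 3) := Subgroup.closure (rhoSet trans₁)

/-- The group `Γ₂`. -/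
def Gam₂ : Subgroup (E 3 ≃ᵢ E 3) := Subgroup.closure (rhoSet trans₂)

/-- The isometries `B L_b` with `B` a permutation matrix and `b ∈ Λ/4`. -/
def permSet : Set (E 3 ≃ᵢ E 3) :=
  {g | ∃ B : Matrix.orthogonalGroup (Fin 3) ℝ, ∃ b : E 3,
    (∃ σ : Equiv.Perm (Fin 3), B.1 = σ.permMatrix ℝ) ∧ (4 : ℝ) • b ∈ Lam ∧
      g = ortho B * transl b}

/-- The subgroup `G` of the isometry group of the torus generated by the groups induced by `Γ₁` and
`Γ₂` and by the maps induced by the `B L_b`, `B` a permutation matrix and `b ∈ Λ/4`. -/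
def bigGroup : Subgroup (Torus Lam ≃ᵢ Torus Lam) :=
  Subgroup.closure ((inducedGroup Lam Gam₁ : Set (Torus Lam ≃ᵢ Torus Lam)) ∪
    (inducedGroup Lam Gam₂ : Set (Torus Lam ≃ᵢ Torus Lam)) ∪
    {h | ∃ g ∈ permSet, Induces g h})

/-- The box `[0,1] × [0,1] × [0,2]`. -/
def box : Set (E 3) :=
  {x | x 0 ∈ Set.Icc (0 : ℝ) 1 ∧ x 1 ∈ Set.Icc (0 : ℝ) 1 ∧ x 2 ∈ Set.Icc (0 : ℝ) 2}

/-- The set `ℤ × ℤ × ℝ`. -/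
def verticalLines : Set (E 3) := {x | (∃ m : ℤ, x 0 = m) ∧ ∃ m : ℤ, x 1 = m}

/-- The antipodal relation on the unit sphere of `ℝ³`. -/
def antipodal : Setoid (Metric.sphere (0 : E 3) 1) where
  r x y := x = y ∨ x = -y
  iseqv :=
    { refl := fun _ => Or.inl rfl
      symm := by
        rintro x y (h | h)
        · exact Or.inl h.symm
        · exact Or.inr (by rw [h, neg_neg])
      trans := by
        rintro x y z (h | h) (h' | h')
        · exact Or.inl (h.trans h')
        · exact Or.inr (h.trans h')
        · exact Or.inr (by rw [h, h'])
        · exact Or.inl (by rw [h, h', neg_neg]) }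

/-- The real projective plane. -/
abbrev ProjectivePlane : Type := Quotient antipodal

end FlatOrbifold

end

open FlatOrbifold

/-!
Modulo `Λ` an element of either group has the form `x ↦ χ_j x + c_j` with `c_j` integral. The
choice of the `c_j` makes the elements with `j = 1, 3` glide reflections, so that the only
isometries with fixed points are the half-turns about the lines `{m} × {n} × ℝ` with `m` and `n`
integers. On the first two coordinates the four isometries permute the four unit squares of
`(ℝ / 2ℤ)²` simply transitively, and none of them mixes these coordinates with the third: hence the
fundamental domain `[0,1]² × [0,2]`.

The quotient of `(ℝ / 2ℤ)²` by the half-turn is a pillow, the double of a square, hence a sphere.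
The glide reflections of `Γ₁` do not move the third coordinate and act on the pillow as the
antipodal map, whence `ℝP² × S¹`.

On the torus, for odd `j`, `ρ_j` and `ρ'_j` have the same linear part and glide by half a period
along different axes. Exchanging the two axes and translating by a quarter period conjugates one
into the other. The finite group `G` acts on each eigenspace of the torus, which is
finite-dimensional since the Fourier coefficients of an eigenfunction live on a sphere in the dual
lattice. The dimension of the space of invariants of a subgroup is the average of the character
over the subgroup, and so depends only on the number of its elements in each conjugacy class of
`G`: this is Sunada's theorem.

A fixed line `{m} × {n} × ℝ` becomes a circle of length `2` in the torus. The glide reflections of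
`Γ₁` identify these four circles in pairs, while those of `Γ₂` map each circle to itself, moving it
by half its length. A point is singular exactly if the projection to the orbifold is not locally
injective there, so an isometry of the orbifolds would match the `2` circles with the `4`.
-/

namespace FlatOrbifold

/-! ### Isometries of the form `x ↦ χ_j x + a` -/

section SignedPerm

variable {n : ℕ}

/-- The isometry `x ↦ (ε_i x_{σ i} + a_i)_i` of `ℝⁿ`, a signed permutation of the coordinates
followed by a translation. All isometries of the example are of this form. -/
noncomputable def signedPerm (σ : Equiv.Perm (Fin n)) (ε : Fin n → ℤˣ) (a : Fin n → ℝ) :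
    E n ≃ᵢ E n :=
  IsometryEquiv.mk' (fun x => WithLp.toLp 2 fun i => ((ε i : ℤ) : ℝ) * x (σ i) + a i)
    (fun x => WithLp.toLp 2 fun i => ((ε (σ⁻¹ i) : ℤ) : ℝ) * (x (σ⁻¹ i) - a (σ⁻¹ i)))
    (fun x => by
      ext i
      rcases Int.units_eq_one_or (ε i) with h | h <;> simp [h])
    (Isometry.of_dist_eq fun x y => by
      rw [EuclideanSpace.dist_eq, EuclideanSpace.dist_eq,
        ← Equiv.sum_comp σ fun i => dist (x i) (y i) ^ 2]
      congr! 3 with i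
      rcases Int.units_eq_one_or (ε i) with h | h <;> simp [h])

theorem signedPerm_apply (σ : Equiv.Perm (Fin n)) (ε : Fin n → ℤˣ) (a : Fin n → ℝ) (x : E n)
    (i : Fin n) : signedPerm σ ε a x i = ((ε i : ℤ) : ℝ) * x (σ i) + a i := rfl

theorem signedPerm_mul (σ τ : Equiv.Perm (Fin n)) (ε δ : Fin n → ℤˣ) (a b : Fin n → ℝ) :
    signedPerm σ ε a * signedPerm τ δ b =
      signedPerm (τ * σ) (fun i => ε i * δ (σ i)) (fun i => ((ε i : ℤ) : ℝ) * b (σ i) + a i) := by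
  ext x i
  simp only [IsometryEquiv.mul_apply, signedPerm_apply, Equiv.Perm.mul_apply, Units.val_mul,
    Int.cast_mul]
  ring

theorem signedPerm_one_one_zero : signedPerm (1 : Equiv.Perm (Fin n)) 1 0 = 1 := by
  ext x i
  simp [signedPerm_apply]

theorem signedPerm_inv (σ : Equiv.Perm (Fin n)) (ε : Fin n → ℤˣ) (a : Fin n → ℝ) :
    (signedPerm σ ε a)⁻¹ = signedPerm σ⁻¹ (fun i => ε (σ⁻¹ i))
      (fun i => -(((ε (σ⁻¹ i) : ℤ) : ℝ) * a (σ⁻¹ i))) := by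
  rw [inv_eq_iff_mul_eq_one]
  ext x i
  rw [IsometryEquiv.mul_apply, signedPerm_apply, signedPerm_apply, Equiv.Perm.inv_def,
    Equiv.symm_apply_apply]
  rcases Int.units_eq_one_or (ε i) with h | h <;> simp [h]

theorem transl_apply (b x : E n) : transl b x = x + b := rfl

theorem ortho_apply (B : Matrix.orthogonalGroup (Fin n) ℝ) (x : E n) (i : Fin n) :
    ortho B x i = B.1.mulVec x.ofLp i := rfl

theorem transl_eq_signedPerm (b : E n) : transl b = signedPerm 1 1 b.ofLp := by
  ext x i
  simp [signedPerm_apply, transl_apply]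

theorem ortho_mul_transl_eq_signedPerm {B : Matrix.orthogonalGroup (Fin n) ℝ}
    {σ : Equiv.Perm (Fin n)} (hB : B.1 = σ.permMatrix ℝ) (b : E n) :
    ortho B * transl b = signedPerm σ 1 fun i => b (σ i) := by
  ext x i
  simp [signedPerm_apply, ortho_apply, transl_apply, hB, Matrix.permMatrix_mulVec]

end SignedPerm

/-- The signs on the diagonal of `χ_j`. The indices `0, 1, 2, 3` multiply like the elements of the
Klein four-group, with exclusive or as the group law. -/
def sgn : Fin 4 → Fin 3 → ℤˣ := ![![1, 1, 1], ![-1, 1, 1], ![-1, -1, 1], ![1, -1, 1]]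

theorem sgn_xor (j k : Fin 4) (i : Fin 3) : sgn (j ^^^ k) i = sgn j i * sgn k i := by
  revert j k i; decide

theorem sgn_apply_two (j : Fin 4) : sgn j 2 = 1 := by revert j; decide

theorem sgn_injective : Function.Injective sgn := by decide

theorem chi_val (j : Fin 4) : (chi j).1 = Matrix.diagonal fun i => ((sgn j i : ℤ) : ℝ) := by
  ext a b
  fin_cases j <;> fin_cases a <;> fin_cases b <;> simp [chi, sgn, Matrix.diagonal]

/-- The isometry `x ↦ χ_j x + b` for an integral vector `b`. -/
noncomputable def diag (j : Fin 4) (b : Fin 3 → ℤ) : E 3 ≃ᵢ E 3 := signedPerm 1 (sgn j) fun i => b i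

theorem diag_apply (j : Fin 4) (b : Fin 3 → ℤ) (x : E 3) (i : Fin 3) :
    diag j b x i = ((sgn j i : ℤ) : ℝ) * x i + b i := rfl

theorem diag_mul (j k : Fin 4) (a b : Fin 3 → ℤ) :
    diag j a * diag k b = diag (j ^^^ k) fun i => sgn j i * b i + a i := by
  rw [diag, diag, signedPerm_mul, diag]
  congr <;> funext i <;> simp [sgn_xor]

theorem diag_zero_zero : diag 0 0 = 1 := by
  ext x i
  fin_cases i <;> simp [diag_apply, sgn]

theorem diag_inv (j : Fin 4) (b : Fin 3 → ℤ) : (diag j b)⁻¹ = diag j fun i => -(sgn j i * b i) := by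
  have hjj : j ^^^ j = 0 := by revert j; decide
  rw [inv_eq_iff_mul_eq_one, diag_mul, ← diag_zero_zero, hjj]
  congr 1
  funext i
  rcases Int.units_eq_one_or (sgn j i) with h | h <;> simp [h]

theorem rho_mul_transl_eq_diag {b : Fin 4 → E 3} {c : Fin 4 → Fin 3 → ℤ}
    (hb : ∀ j i, b j i = c j i) {v : E 3} {m : Fin 3 → ℤ} (hv : ∀ i, v i = 2 * m i) (j : Fin 4) :
    rho b j * transl v = diag j fun i => sgn j i * (2 * m i + c j i) := by
  ext x i
  simp only [rho, IsometryEquiv.mul_apply, ortho_apply, chi_val, Matrix.mulVec_diagonal,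
    transl_apply, PiLp.add_apply, hb, hv, diag_apply]
  push_cast
  ring

/-- Whether the map `t ↦ ε t + b` exchanges the intervals `[0,1]` and `[1,2]` modulo `2`. -/
def swaps (ε : ℤˣ) (b : ℤ) : Bool := decide (ε = 1 ↔ Odd b)

/-- The properties of integral translational parts `c_j` (modulo `2`) on which the example rests:
the isometries `x ↦ χ_j x + c_j` form a group modulo `Λ`; those with `j = 1, 3` are glide
reflections, so that only `χ_2` has fixed points; and they permute the four unit squares of
`(ℝ / 2ℤ)²` simply transitively. -/
structure GlideSystem (c : Fin 4 → Fin 3 → ℤ) : Prop where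
  zero : c 0 = 0
  two : c 2 = 0
  cocycle : ∀ j k i, 2 ∣ sgn j i * c k i + c j i - c (j ^^^ k) i
  glide : ∀ j, j ≠ 0 → j ≠ 2 → ∃ i, sgn j i = 1 ∧ Odd (c j i)
  bijective_swaps : Function.Bijective fun j => (swaps (sgn j 0) (c j 0), swaps (sgn j 1) (c j 1))

/-- `Γ` consists of the isometries with linear part `χ_j` and translational part in `c_j + Λ`. -/
structure IsGlideGroup (Γ : Subgroup (E 3 ≃ᵢ E 3)) (c : Fin 4 → Fin 3 → ℤ) : Prop
    extends GlideSystem c where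
  mem_iff : ∀ g, g ∈ Γ ↔ ∃ (j : Fin 4) (m : Fin 3 → ℤ), g = diag j fun i => 2 * m i + c j i

/-- The isometries with linear part `χ_j` and translational part in `c_j + Λ`. -/
def GlideSystem.group {c : Fin 4 → Fin 3 → ℤ} (hc : GlideSystem c) : Subgroup (E 3 ≃ᵢ E 3) where
  carrier := {g | ∃ (j : Fin 4) (m : Fin 3 → ℤ), g = diag j fun i => 2 * m i + c j i}
  one_mem' := ⟨0, 0, by rw [← diag_zero_zero, hc.zero]; rfl⟩
  mul_mem' := by
    rintro _ _ ⟨j, m, rfl⟩ ⟨k, l, rfl⟩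
    choose d hd using hc.cocycle j k
    refine ⟨j ^^^ k, fun i => m i + sgn j i * l i + d i, ?_⟩
    rw [diag_mul]
    congr 1
    funext i
    linear_combination hd i
  inv_mem' := by
    rintro _ ⟨j, m, rfl⟩
    refine ⟨j, fun i => if sgn j i = 1 then -m i - c j i else m i, ?_⟩
    rw [diag_inv]
    congr 1
    funext i
    rcases Int.units_eq_one_or (sgn j i) with h | h <;> simp [h]
    ring

theorem rhoSet_eq {b : Fin 4 → E 3} {c : Fin 4 → Fin 3 → ℤ} (hb : ∀ j i, b j i = c j i) :
    rhoSet b = {g | ∃ (j : Fin 4) (m : Fin 3 → ℤ), g = diag j fun i => 2 * m i + c j i} := by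
  ext g
  constructor
  · rintro ⟨j, v, hv, rfl⟩
    choose m hm using hv
    refine ⟨j, fun i => if sgn j i = 1 then m i else -m i - c j i, ?_⟩
    rw [rho_mul_transl_eq_diag hb hm]
    congr 1
    funext i
    rcases Int.units_eq_one_or (sgn j i) with h | h <;> simp [h]
    ring
  · rintro ⟨j, m, rfl⟩
    refine ⟨j, WithLp.toLp 2 fun i => 2 * ((if sgn j i = 1 then m i else -m i - c j i : ℤ) : ℝ),
      fun i => ⟨_, rfl⟩, ?_⟩
    rw [rho_mul_transl_eq_diag hb fun i => rfl]
    congr 1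
    funext i
    rcases Int.units_eq_one_or (sgn j i) with h | h <;> simp [h]
    ring

theorem GlideSystem.closure_rhoSet {b : Fin 4 → E 3} {c : Fin 4 → Fin 3 → ℤ} (hc : GlideSystem c)
    (hb : ∀ j i, b j i = c j i) : Subgroup.closure (rhoSet b) = hc.group := by
  rw [rhoSet_eq hb]
  exact hc.group.closure_eq

theorem GlideSystem.isGlideGroup {c : Fin 4 → Fin 3 → ℤ} (hc : GlideSystem c) :
    IsGlideGroup hc.group c :=
  { hc with mem_iff := fun _ => Iff.rfl }

theorem IsGlideGroup.coe_eq_rhoSet {Γ : Subgroup (E 3 ≃ᵢ E 3)} {b : Fin 4 → E 3}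
    {c : Fin 4 → Fin 3 → ℤ} (hΓ : IsGlideGroup Γ c) (hb : ∀ j i, b j i = c j i) :
    (Γ : Set (E 3 ≃ᵢ E 3)) = rhoSet b := by
  rw [rhoSet_eq hb]
  exact Set.ext hΓ.mem_iff

/-- The coordinates of `trans₁`. -/
def off₁ : Fin 4 → Fin 3 → ℤ := ![![0, 0, 0], ![1, 1, 0], ![0, 0, 0], ![1, 1, 0]]

/-- The coordinates of `trans₂`. -/
def off₂ : Fin 4 → Fin 3 → ℤ := ![![0, 0, 0], ![0, 0, 1], ![0, 0, 0], ![0, 0, 1]]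

theorem trans₁_apply (j : Fin 4) (i : Fin 3) : trans₁ j i = off₁ j i := by
  fin_cases j <;> fin_cases i <;> simp [trans₁, off₁]

theorem trans₂_apply (j : Fin 4) (i : Fin 3) : trans₂ j i = off₂ j i := by
  fin_cases j <;> fin_cases i <;> simp [trans₂, off₂]

theorem glideSystem_off₁ : GlideSystem off₁ := by constructor <;> decide

theorem glideSystem_off₂ : GlideSystem off₂ := by constructor <;> decide

theorem isGlideGroup_Gam₁ : IsGlideGroup Gam₁ off₁ := by
  rw [Gam₁, glideSystem_off₁.closure_rhoSet trans₁_apply]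
  exact glideSystem_off₁.isGlideGroup

theorem isGlideGroup_Gam₂ : IsGlideGroup Gam₂ off₂ := by
  rw [Gam₂, glideSystem_off₂.closure_rhoSet trans₂_apply]
  exact glideSystem_off₂.isGlideGroup

/-! ### Fixed points and the fundamental domain -/

variable {Γ : Subgroup (E 3 ≃ᵢ E 3)} {c : Fin 4 → Fin 3 → ℤ}

/-- The rotation by `π` about the vertical line through `x`. -/
noncomputable def halfTurn (x : E 3) : E 3 ≃ᵢ E 3 :=
  signedPerm 1 (sgn 2) fun i => x i - ((sgn 2 i : ℤ) : ℝ) * x i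

theorem halfTurn_apply (x y : E 3) (i : Fin 3) :
    halfTurn x y i = ((sgn 2 i : ℤ) : ℝ) * y i + (x i - ((sgn 2 i : ℤ) : ℝ) * x i) := rfl

theorem halfTurn_apply_self (x : E 3) : halfTurn x x = x := by
  ext i
  rw [halfTurn_apply, add_sub_cancel]

theorem halfTurn_ne_one (x : E 3) : halfTurn x ≠ 1 := by
  intro h
  have := congrArg (fun g : E 3 ≃ᵢ E 3 => g (x + EuclideanSpace.single 0 1) 0) h
  simp [halfTurn_apply, sgn] at this
  linarith

theorem IsGlideGroup.exists_eq_diag_two_of_apply_eq (hΓ : IsGlideGroup Γ c) {g : E 3 ≃ᵢ E 3}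
    {x : E 3} (hg : g ∈ Γ) (h1 : g ≠ 1) (hx : g x = x) :
    ∃ m : Fin 3 → ℤ, g = diag 2 fun i => 2 * m i := by
  obtain ⟨j, m, rfl⟩ := (hΓ.mem_iff g).1 hg
  have hfix (i : Fin 3) (hs : sgn j i = 1) : 2 * m i + c j i = 0 := by
    have := congrArg (fun y : E 3 => y i) hx
    simp only [diag_apply, hs, Units.val_one, Int.cast_one, one_mul, add_eq_left] at this
    exact_mod_cast this
  rcases eq_or_ne j 0 with rfl | h0
  · refine absurd ?_ h1
    rw [← diag_zero_zero]
    congr 1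
    funext i
    exact hfix i (by revert i; decide)
  rcases eq_or_ne j 2 with rfl | h2
  · exact ⟨m, by simp [hΓ.two]⟩
  obtain ⟨i, hs, k, hk⟩ := hΓ.glide j h0 h2
  have := hfix i hs
  omega

theorem IsGlideGroup.eq_halfTurn_of_apply_eq (hΓ : IsGlideGroup Γ c) {g : E 3 ≃ᵢ E 3} {x : E 3}
    (hg : g ∈ Γ) (h1 : g ≠ 1) (hx : g x = x) : x ∈ verticalLines ∧ g = halfTurn x := by
  obtain ⟨m, rfl⟩ := hΓ.exists_eq_diag_two_of_apply_eq hg h1 hx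
  have hfix (i : Fin 3) : ((sgn 2 i : ℤ) : ℝ) * x i + (2 * m i : ℤ) = x i :=
    congrArg (fun y : E 3 => y i) hx
  refine ⟨⟨⟨m 0, ?_⟩, m 1, ?_⟩, ?_⟩
  · have := hfix 0
    simp [sgn] at this
    linarith
  · have := hfix 1
    simp [sgn] at this
    linarith
  · ext y i
    rw [diag_apply, halfTurn_apply]
    linarith [hfix i]

theorem IsGlideGroup.halfTurn_mem (hΓ : IsGlideGroup Γ c) {x : E 3} (hx : x ∈ verticalLines) :
    halfTurn x ∈ Γ := by
  obtain ⟨⟨a, ha⟩, b, hb⟩ := hx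
  refine (hΓ.mem_iff _).2 ⟨2, ![a, b, 0], ?_⟩
  ext y i
  rw [halfTurn_apply, diag_apply, hΓ.two]
  fin_cases i <;> simp [sgn, ha, hb] <;> ring

theorem IsGlideGroup.existsUnique_apply_eq (hΓ : IsGlideGroup Γ c) {x : E 3}
    (hx : x ∈ verticalLines) : ∃! g : E 3 ≃ᵢ E 3, g ∈ Γ ∧ g ≠ 1 ∧ g x = x :=
  ⟨halfTurn x, ⟨hΓ.halfTurn_mem hx, halfTurn_ne_one x, halfTurn_apply_self x⟩,
    fun _ ⟨hg, h1, hgx⟩ => (hΓ.eq_halfTurn_of_apply_eq hg h1 hgx).2⟩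

theorem IsGlideGroup.setOf_apply_eq (hΓ : IsGlideGroup Γ c) :
    {x : E 3 | ∃ g ∈ Γ, g ≠ 1 ∧ g x = x} = verticalLines :=
  Set.Subset.antisymm (fun _ ⟨_, hg, h1, hx⟩ => (hΓ.eq_halfTurn_of_apply_eq hg h1 hx).1)
    fun x hx => ⟨halfTurn x, hΓ.halfTurn_mem hx, halfTurn_ne_one x, halfTurn_apply_self x⟩

theorem nonempty_isotropy_mulEquiv_zmod_two {M : Type*} [PseudoMetricSpace M]
    {Γ : Subgroup (M ≃ᵢ M)} {x : M} (h : ∃! g : M ≃ᵢ M, g ∈ Γ ∧ g ≠ 1 ∧ g x = x) :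
    Nonempty (isotropy Γ x ≃* Multiplicative (ZMod 2)) := by
  obtain ⟨g, ⟨hg, h1, hgx⟩, huniq⟩ := h
  have hcard : Nat.card (isotropy Γ x) = 2 := by
    refine Nat.card_eq_two_iff.2 ⟨1, ⟨⟨g, hg⟩, hgx⟩, ?_, ?_⟩
    · exact fun h => h1 (congrArg (fun k : isotropy Γ x => (k : Γ).1) h).symm
    · refine Set.eq_univ_of_forall fun k => or_iff_not_imp_left.2 fun hk => ?_
      exact Subtype.ext (Subtype.ext (huniq _ ⟨k.1.2,
        fun h => hk (Subtype.ext (Subtype.ext h)), k.2⟩))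
  have : Fact (Nat.Prime 2) := ⟨Nat.prime_two⟩
  exact ⟨mulEquivOfPrimeCardEq hcard (by simp)⟩

theorem isotropy_ne_bot_iff {M : Type*} [PseudoMetricSpace M] {Γ : Subgroup (M ≃ᵢ M)} {x : M} :
    isotropy Γ x ≠ ⊥ ↔ ∃ g ∈ Γ, g ≠ 1 ∧ g x = x := by
  rw [Subgroup.ne_bot_iff_exists_ne_one]
  constructor
  · rintro ⟨⟨g, hg⟩, h1⟩
    exact ⟨g.1, g.2, fun h => h1 (Subtype.ext (Subtype.ext h)), hg⟩
  · rintro ⟨g, hg, h1, hx⟩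
    exact ⟨⟨⟨g, hg⟩, hx⟩, fun h => h1 (congrArg (fun k : isotropy Γ x => (k : Γ).1) h)⟩

theorem IsGlideGroup.isotropy_ne_bot_iff (hΓ : IsGlideGroup Γ c) {x : E 3} :
    isotropy Γ x ≠ ⊥ ↔ x ∈ verticalLines := by
  rw [FlatOrbifold.isotropy_ne_bot_iff, ← hΓ.setOf_apply_eq, Set.mem_ofPred_eq]

theorem box_eq_preimage :
    box = WithLp.ofLp ⁻¹' Set.univ.pi fun i => Set.Icc (0 : ℝ) ((![1, 1, 2] : Fin 3 → ℝ) i) := by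
  ext x
  simp only [box, Set.mem_ofPred_eq, Set.mem_preimage, Set.mem_univ_pi, Fin.forall_fin_succ]
  simp

theorem interior_box :
    interior box = {x : E 3 | x 0 ∈ Set.Ioo (0 : ℝ) 1 ∧ x 1 ∈ Set.Ioo (0 : ℝ) 1 ∧
      x 2 ∈ Set.Ioo (0 : ℝ) 2} := by
  have h := (PiLp.homeomorph 2 fun _ : Fin 3 => ℝ).preimage_interior
    (Set.univ.pi fun i => Set.Icc (0 : ℝ) ((![1, 1, 2] : Fin 3 → ℝ) i))
  rw [interior_pi_set Set.finite_univ] at h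
  refine (congrArg interior box_eq_preimage).trans (h.symm.trans ?_)
  ext x
  simp [Set.mem_pi, Fin.forall_fin_succ, PiLp.homeomorph]

theorem nonempty_interior_box : (interior box).Nonempty := by
  rw [interior_box]
  exact ⟨!₂[1 / 2, 1 / 2, 1], by refine ⟨?_, ?_, ?_⟩ <;> constructor <;> simp <;> norm_num⟩

theorem isCompact_box : IsCompact box := by
  rw [box_eq_preimage]
  exact (PiLp.homeomorph 2 fun _ : Fin 3 => ℝ).isCompact_preimage.2
    (isCompact_univ_pi fun _ => isCompact_Icc)

theorem swaps_two_mul_add (ε : ℤˣ) (m b : ℤ) : swaps ε (2 * m + b) = swaps ε b := by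
  simp [swaps, Int.odd_add']

theorem exists_int_mem_Icc (a t : ℝ) : ∃ m : ℤ, t + 2 * m ∈ Set.Icc a (a + 2) := by
  obtain ⟨m, hm, -⟩ := existsUnique_add_zsmul_mem_Ico two_pos t a
  rw [zsmul_eq_mul, mul_comm] at hm
  exact ⟨m, Set.Ico_subset_Icc_self hm⟩

theorem exists_forall_swaps_eq_imp (t : ℝ) :
    ∃ p : Bool, ∀ ε b, swaps ε b = p →
      ∃ m : ℤ, ((ε : ℤ) : ℝ) * t + (2 * m + b : ℤ) ∈ Set.Icc (0 : ℝ) 1 := by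
  obtain ⟨k, hk⟩ := exists_int_mem_Icc (-1) t
  obtain ⟨hl, hu⟩ := hk
  rcases le_total 0 (t + 2 * k) with h | h
  · refine ⟨false, fun ε b hs => ?_⟩
    rcases Int.units_eq_one_or ε with rfl | rfl
    · obtain ⟨d, rfl⟩ : Even b := by simpa [swaps] using hs
      exact ⟨k - d, by push_cast; constructor <;> linarith⟩
    · obtain ⟨d, rfl⟩ : Odd b := by simpa [swaps] using hs
      exact ⟨-k - d, by push_cast; constructor <;> linarith⟩
  · refine ⟨true, fun ε b hs => ?_⟩
    rcases Int.units_eq_one_or ε with rfl | rfl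
    · obtain ⟨d, rfl⟩ : Odd b := by simpa [swaps] using hs
      exact ⟨k - d, by push_cast; constructor <;> linarith⟩
    · obtain ⟨d, rfl⟩ : Even b := by simpa [swaps] using hs
      exact ⟨-k - d, by push_cast; constructor <;> linarith⟩

theorem eq_zero_of_add_mem_Ioo {t : ℝ} {b : ℤ} {r : ℕ} (hb : (r : ℤ) ∣ b)
    (ht : t ∈ Set.Ioo (0 : ℝ) r) (h : t + b ∈ Set.Ioo (0 : ℝ) r) : b = 0 := by
  have hl : (-r : ℝ) < b := by linarith [ht.2, h.1]
  have hu : (b : ℝ) < r := by linarith [ht.1, h.2]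
  exact Int.eq_zero_of_abs_lt_dvd hb (abs_lt.2 ⟨by exact_mod_cast hl, by exact_mod_cast hu⟩)

theorem swaps_eq_false_of_mem_Ioo {t : ℝ} {ε : ℤˣ} {b : ℤ} (ht : t ∈ Set.Ioo (0 : ℝ) 1)
    (h : ((ε : ℤ) : ℝ) * t + b ∈ Set.Ioo (0 : ℝ) 1) : swaps ε b = false := by
  obtain ⟨ht0, ht1⟩ := ht
  obtain ⟨h0, h1⟩ := h
  rcases Int.units_eq_one_or ε with rfl | rfl <;> simp at h0 h1
  · have hl : (-1 : ℝ) < b := by linarith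
    have hu : (b : ℝ) < 1 := by linarith
    norm_cast at hl hu
    obtain rfl : b = 0 := by omega
    rfl
  · have hl : (0 : ℝ) < b := by linarith
    have hu : (b : ℝ) < 2 := by linarith
    norm_cast at hl hu
    obtain rfl : b = 1 := by omega
    rfl

theorem IsGlideGroup.exists_apply_mem_box (hΓ : IsGlideGroup Γ c) (x : E 3) :
    ∃ g ∈ Γ, g x ∈ box := by
  obtain ⟨p, hp⟩ := exists_forall_swaps_eq_imp (x 0)
  obtain ⟨q, hq⟩ := exists_forall_swaps_eq_imp (x 1)
  obtain ⟨j, hj⟩ := hΓ.bijective_swaps.2 (p, q)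
  obtain ⟨m₀, h₀⟩ := hp _ _ (congrArg Prod.fst hj)
  obtain ⟨m₁, h₁⟩ := hq _ _ (congrArg Prod.snd hj)
  obtain ⟨m₂, h₂⟩ := exists_int_mem_Icc 0 (((sgn j 2 : ℤ) : ℝ) * x 2 + c j 2)
  refine ⟨_, (hΓ.mem_iff _).2 ⟨j, ![m₀, m₁, m₂], rfl⟩, h₀, h₁, ?_⟩
  obtain ⟨hl, hu⟩ := h₂
  rw [diag_apply]
  simp only [Matrix.cons_val]
  push_cast
  constructor <;> linarith

theorem IsGlideGroup.eq_one_of_mem_interior_box (hΓ : IsGlideGroup Γ c) {g : E 3 ≃ᵢ E 3}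
    (hg : g ∈ Γ) {x : E 3} (hx : x ∈ interior box) (hgx : g x ∈ interior box) : g = 1 := by
  rw [interior_box] at hx hgx
  obtain ⟨hx₀, hx₁, hx₂⟩ := hx
  obtain ⟨j, m, rfl⟩ := (hΓ.mem_iff g).1 hg
  simp only [Set.mem_ofPred_eq, diag_apply] at hgx
  obtain ⟨h₀, h₁, h₂⟩ := hgx
  have hswaps (k : Fin 4) (hk : k = j ∨ k = 0) :
      (swaps (sgn k 0) (c k 0), swaps (sgn k 1) (c k 1)) = (false, false) := by
    rcases hk with rfl | rfl
    · exact Prod.ext ((swaps_two_mul_add _ (m 0) _).symm.trans (swaps_eq_false_of_mem_Ioo hx₀ h₀))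
        ((swaps_two_mul_add _ (m 1) _).symm.trans (swaps_eq_false_of_mem_Ioo hx₁ h₁))
    · rw [hΓ.zero]
      decide
  obtain rfl : j = 0 :=
    hΓ.bijective_swaps.1 ((hswaps j (Or.inl rfl)).trans (hswaps 0 (Or.inr rfl)).symm)
  have hsgn : sgn 0 = 1 := by decide
  simp only [hsgn, hΓ.zero, Pi.one_apply, Units.val_one, Int.cast_one, one_mul, Pi.zero_apply,
    add_zero] at h₀ h₁ h₂
  rw [← diag_zero_zero, hΓ.zero]
  congr 1
  funext i
  simp only [Pi.zero_apply, add_zero]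
  fin_cases i
  · exact eq_zero_of_add_mem_Ioo (r := 1) (by simp) (by simpa using hx₀) (by simpa using h₀)
  · exact eq_zero_of_add_mem_Ioo (r := 1) (by simp) (by simpa using hx₁) (by simpa using h₁)
  · exact eq_zero_of_add_mem_Ioo (r := 2) (by simp) (by simpa using hx₂) (by simpa using h₂)

theorem IsGlideGroup.isClosedFundamentalDomain_box (hΓ : IsGlideGroup Γ c) :
    IsClosedFundamentalDomain Γ box := by
  refine ⟨isCompact_box.isClosed, hΓ.exists_apply_mem_box, fun g hg h1 => ?_⟩
  rw [Set.disjoint_left]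
  rintro _ ⟨x, hx, rfl⟩ hgx
  exact h1 (hΓ.eq_one_of_mem_interior_box hg hx hgx)

/-! ### Discreteness, cocompactness and orientability -/

theorem continuous_isometryEquiv_apply {M : Type*} [PseudoMetricSpace M] (p : M) :
    Continuous fun g : M ≃ᵢ M => g p :=
  (continuous_eval_const (F := C(M, M)) p).comp
    (continuous_induced_dom (f := fun g : M ≃ᵢ M => (⟨g, g.continuous⟩ : C(M, M))))

theorem IsClosedFundamentalDomain.discreteTopology {M : Type*} [PseudoMetricSpace M]
    {Γ : Subgroup (M ≃ᵢ M)} {D : Set M} (h : IsClosedFundamentalDomain Γ D)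
    (hD : (interior D).Nonempty) : DiscreteTopology Γ := by
  obtain ⟨p, hp⟩ := hD
  rw [discreteTopology_iff_isOpen_singleton]
  intro g
  have hopen : IsOpen {k : Γ | k.1 p ∈ g.1 '' interior D} :=
    (g.1.toHomeomorph.isOpenMap _ isOpen_interior).preimage
      ((continuous_isometryEquiv_apply p).comp continuous_subtype_val)
  suffices {k : Γ | k.1 p ∈ g.1 '' interior D} = {g} from this ▸ hopen
  refine Set.Subset.antisymm ?_ (Set.singleton_subset_iff.2 ⟨p, hp, rfl⟩)
  rintro k ⟨q, hq, hqp⟩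
  by_contra hkg
  have hne : g.1⁻¹ * k.1 ≠ 1 := fun h1 => hkg (Subtype.ext (inv_mul_eq_one.1 h1).symm)
  refine Set.disjoint_left.1 (h.2.2 _ (Γ.mul_mem (Γ.inv_mem g.2) k.2) hne) ⟨p, hp, rfl⟩ ?_
  rwa [IsometryEquiv.mul_apply, ← hqp, IsometryEquiv.inv_apply_self]

theorem isCompact_unitary {H : Type*} [NormedAddCommGroup H] [InnerProductSpace ℝ H]
    [FiniteDimensional ℝ H] [CompleteSpace H] :
    IsCompact (unitary (H →L[ℝ] H) : Set (H →L[ℝ] H)) := by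
  have : ProperSpace (H →L[ℝ] H) := FiniteDimensional.proper ℝ _
  refine Metric.isCompact_of_isClosed_isBounded isClosed_unitary ?_
  refine isBounded_iff_forall_norm_le.2 ⟨1, fun u hu => ?_⟩
  refine ContinuousLinearMap.opNorm_le_bound _ zero_le_one fun x => ?_
  rw [one_mul]
  exact ((Unitary.linearIsometryEquiv ⟨u, hu⟩).norm_map x).le

section LinearPart

variable {n : ℕ}

/-- The linear part of an isometry of `ℝⁿ`. -/
noncomputable abbrev linearPart (g : E n ≃ᵢ E n) : E n ≃ₗᵢ[ℝ] E n :=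
  g.toRealAffineIsometryEquiv.linearIsometryEquiv

theorem linearPart_sub (g : E n ≃ᵢ E n) (x y : E n) : linearPart g (x - y) = g x - g y :=
  g.toRealAffineIsometryEquiv.map_vsub x y

theorem eq_linearPart_mul_transl {g : E n ≃ᵢ E n} {p : E n} (h : g p = 0) :
    g = (linearPart g).toIsometryEquiv * transl (-p) := by
  ext1 x
  change g x = linearPart g (x + -p)
  rw [← sub_eq_add_neg, linearPart_sub, h, sub_zero]

theorem continuous_unitary_mul_transl :
    Continuous fun q : unitary (E n →L[ℝ] E n) × E n =>
      (Unitary.linearIsometryEquiv q.1).toIsometryEquiv * transl (-q.2) := by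
  refine continuous_induced_rng.2 (ContinuousMap.continuous_of_continuous_uncurry _ ?_)
  have hlin : Continuous fun q : (unitary (E n →L[ℝ] E n) × E n) × E n => q.1.1.1 :=
    continuous_subtype_val.comp (continuous_fst.comp continuous_fst)
  exact hlin.clm_apply (continuous_snd.add (continuous_snd.comp continuous_fst).neg)

theorem compactSpace_quotient_of_isCompact {Γ : Subgroup (E n ≃ᵢ E n)} {D : Set (E n)}
    (hD : IsCompact D) (h : ∀ x, ∃ g ∈ Γ, g x ∈ D) : CompactSpace ((E n ≃ᵢ E n) ⧸ Γ) := by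
  let φ (q : unitary (E n →L[ℝ] E n) × E n) : E n ≃ᵢ E n :=
    (Unitary.linearIsometryEquiv q.1).toIsometryEquiv * transl (-q.2)
  have hcompact : IsCompact ((QuotientGroup.mk : _ → (E n ≃ᵢ E n) ⧸ Γ) ∘ φ '' Set.univ ×ˢ D) :=
    ((isCompact_iff_isCompact_univ.1 isCompact_unitary).prod hD).image
      (continuous_quot_mk.comp continuous_unitary_mul_transl)
  refine ⟨hcompact.of_isClosed_subset isClosed_univ fun q _ => ?_⟩
  induction q using QuotientGroup.induction_on with
  | H g =>
    obtain ⟨k, hk, hd⟩ := h (g⁻¹ 0)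
    have hzero : (g * k⁻¹) (k (g⁻¹ 0)) = 0 := by
      rw [IsometryEquiv.mul_apply, IsometryEquiv.inv_apply_self, IsometryEquiv.apply_inv_self]
    refine ⟨(Unitary.linearIsometryEquiv.symm (linearPart (g * k⁻¹)), k (g⁻¹ 0)), ⟨trivial, hd⟩, ?_⟩
    simp only [Function.comp_apply, φ, MulEquiv.apply_symm_apply, ← eq_linearPart_mul_transl hzero]
    rw [QuotientGroup.eq, mul_inv_rev, inv_inv, inv_mul_cancel_right]
    exact hk

theorem Orientable.zero_lt_det_linearPart {Γ : Subgroup (E n ≃ᵢ E n)} (h : Orientable Γ)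
    {g : E n ≃ᵢ E n} (hg : g ∈ Γ) : 0 < LinearMap.det (linearPart g).toLinearMap := by
  obtain ⟨o, hloc, ho⟩ := h
  have h1 := ho g hg 0
  rw [hloc.apply_eq_of_preconnectedSpace (g 0) 0] at h1
  exact ((o 0).map_eq_iff_det_pos _ (by simp)).1 h1

end LinearPart

theorem IsGlideGroup.isCrystallographic (hΓ : IsGlideGroup Γ c) : IsCrystallographic Γ :=
  ⟨hΓ.isClosedFundamentalDomain_box.discreteTopology nonempty_interior_box,
    compactSpace_quotient_of_isCompact isCompact_box hΓ.exists_apply_mem_box⟩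

theorem linearPart_diag_apply (j : Fin 4) (b : Fin 3 → ℤ) (x : E 3) (i : Fin 3) :
    linearPart (diag j b) x i = ((sgn j i : ℤ) : ℝ) * x i := by
  have := linearPart_sub (diag j b) x 0
  rw [sub_zero] at this
  simp [this, diag_apply]

theorem IsGlideGroup.not_orientable (hΓ : IsGlideGroup Γ c) : ¬ Orientable Γ := by
  intro h
  have hdet := h.zero_lt_det_linearPart ((hΓ.mem_iff _).2 ⟨1, 0, rfl⟩)
  rw [← LinearMap.det_toMatrix (EuclideanSpace.basisFun (Fin 3) ℝ).toBasis, Matrix.det_fin_three]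
    at hdet
  simp [LinearMap.toMatrix_apply, linearPart_diag_apply, sgn] at hdet
  linarith

/-! ### The sphere as a double square -/

section OrbitSpace

variable {M : Type*} [PseudoMetricSpace M] {Γ : Subgroup (M ≃ᵢ M)}

instance (Γ : Subgroup (M ≃ᵢ M)) : ContinuousConstSMul Γ M := ⟨fun g => g.1.continuous⟩

theorem proj_eq_proj_iff {x y : M} : proj Γ x = proj Γ y ↔ ∃ g ∈ Γ, g x = y := by
  rw [eq_comm, proj, proj, Quotient.eq, MulAction.orbitRel_apply, MulAction.mem_orbit_iff]
  exact ⟨fun ⟨g, hg⟩ => ⟨g.1, g.2, hg⟩, fun ⟨g, hg, hx⟩ => ⟨⟨g, hg⟩, hx⟩⟩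

theorem proj_apply_eq {g : M ≃ᵢ M} (hg : g ∈ Γ) (x : M) : proj Γ (g x) = proj Γ x :=
  (proj_eq_proj_iff.2 ⟨g, hg, rfl⟩).symm

theorem isOpenQuotientMap_proj : IsOpenQuotientMap (proj Γ) :=
  MulAction.isOpenQuotientMap_quotientMk

theorem compactSpace_orbitSpace {D : Set M} (hD : IsCompact D) (h : ∀ x, ∃ g ∈ Γ, g x ∈ D) :
    CompactSpace (OrbitSpace Γ) := by
  refine ⟨(hD.image isOpenQuotientMap_proj.continuous).of_isClosed_subset isClosed_univ ?_⟩
  rintro p -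
  obtain ⟨x, rfl⟩ := isOpenQuotientMap_proj.surjective p
  obtain ⟨g, hg, hx⟩ := h x
  exact ⟨g x, hx, proj_apply_eq hg x⟩

theorem exists_equiv_of_eq_iff {X : Type*} {f : M → X} (hsurj : Function.Surjective f)
    (hiff : ∀ x y, f x = f y ↔ ∃ g ∈ Γ, g x = y) :
    ∃ F : OrbitSpace Γ ≃ X, F ∘ proj Γ = f := by
  have hiff' (x y : M) : f x = f y ↔ proj Γ x = proj Γ y := (hiff x y).trans proj_eq_proj_iff.symm
  let F : OrbitSpace Γ → X := Quotient.lift f fun x y hxy => (hiff' x y).2 (Quotient.sound hxy)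
  refine ⟨Equiv.ofBijective F ⟨?_, fun q => (hsurj q).imp' (proj Γ) fun _ hx => hx⟩, rfl⟩
  rintro ⟨x⟩ ⟨y⟩ h
  exact (hiff' x y).1 h

theorem nonempty_homeomorph_of_eq_iff {X : Type*} [TopologicalSpace X] [T2Space X]
    [CompactSpace (OrbitSpace Γ)] {f : M → X} (hf : Continuous f) (hsurj : Function.Surjective f)
    (hiff : ∀ x y, f x = f y ↔ ∃ g ∈ Γ, g x = y) : Nonempty (OrbitSpace Γ ≃ₜ X) := by
  obtain ⟨F, rfl⟩ := exists_equiv_of_eq_iff hsurj hiff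
  exact ⟨Continuous.homeoOfEquivCompactToT2 (isOpenQuotientMap_proj.continuous_comp_iff.1 hf)⟩

theorem exists_homeomorph_of_eq_iff {X : Type*} [TopologicalSpace X] {f : M → X}
    (hf : IsOpenQuotientMap f) (hiff : ∀ x y, f x = f y ↔ ∃ g ∈ Γ, g x = y) :
    ∃ F : OrbitSpace Γ ≃ₜ X, F ∘ proj Γ = f := by
  obtain ⟨F, rfl⟩ := exists_equiv_of_eq_iff hf.surjective hiff
  have hF : IsOpenQuotientMap F := (isOpenQuotientMap_proj.of_comp_iff).1 hf
  exact ⟨F.toHomeomorphOfContinuousOpen hF.continuous hF.isOpenMap, rfl⟩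

end OrbitSpace

instance : T2Space ProjectivePlane := by
  let f : ProjectivePlane → Matrix (Fin 3) (Fin 3) ℝ := Quotient.lift (s := antipodal)
    (fun v => Matrix.vecMulVec v.1.ofLp v.1.ofLp) (by
      rintro a b (rfl | rfl)
      · rfl
      · simp [Matrix.neg_vecMulVec, Matrix.vecMulVec_neg])
  refine T2Space.of_injective_continuous (f := f) ?_ ?_
  · rintro ⟨a⟩ ⟨b⟩ hab
    have h (i j : Fin 3) : a.1 i * a.1 j = b.1 i * b.1 j := congrFun (congrFun hab i) j
    refine Quotient.sound (s := antipodal) ?_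
    obtain ⟨i, hi⟩ : ∃ i, a.1 i ≠ 0 := by
      by_contra! h0
      exact ne_zero_of_mem_unit_sphere a (PiLp.ext h0)
    rcases mul_self_eq_mul_self_iff.1 (h i i) with h1 | h1
    · refine Or.inl (Subtype.ext (PiLp.ext fun j => mul_left_cancel₀ hi ?_))
      rw [h i j, h1]
    · refine Or.inr (Subtype.ext (PiLp.ext fun j => mul_left_cancel₀ hi ?_))
      exact (h i j).trans (by simp [h1])
  · refine Continuous.quotient_lift (s := antipodal) ?_ _
    exact Continuous.matrix_vecMulVec (by fun_prop) (by fun_prop)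

/-- The coordinates of the elliptical grid mapping `(a, b) ↦ (discCoord a b, discCoord b a)`, a
homeomorphism from the square `[-1, 1]²` onto the closed unit disc. -/
noncomputable def discCoord (a b : ℝ) : ℝ := a * √(1 - b ^ 2 / 2)

theorem discCoord_sq {b : ℝ} (a : ℝ) (hb : b ^ 2 ≤ 1) :
    discCoord a b ^ 2 = a ^ 2 * (1 - b ^ 2 / 2) := by
  rw [discCoord, mul_pow, Real.sq_sqrt (by linarith)]

theorem discCoord_smul (s t : ℤˣ) (a b : ℝ) :
    discCoord ((s : ℤ) * a) ((t : ℤ) * b) = (s : ℤ) * discCoord a b := by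
  rcases Int.units_eq_one_or t with rfl | rfl <;> simp [discCoord, mul_assoc]

theorem eq_of_mul_one_sub_half_eq {A B A' B' : ℝ} (hA : A ≤ 1) (hB : B ≤ 1) (hA' : A' ≤ 1)
    (hB' : B' ≤ 1) (h : A * (1 - B / 2) = A' * (1 - B' / 2))
    (h' : B * (1 - A / 2) = B' * (1 - A' / 2)) : A = A' := by
  have hsub : A - A' = B - B' := by linarith
  have hprod : (A - A') * (2 - A - B') = 0 := by
    linear_combination 2 * h - A * hsub
  rcases mul_eq_zero.1 hprod with h0 | h0 <;> linarith

theorem eq_of_discCoord_eq {a b a' b' : ℝ} (ha : a ^ 2 ≤ 1) (hb : b ^ 2 ≤ 1) (ha' : a' ^ 2 ≤ 1)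
    (hb' : b' ^ 2 ≤ 1) (h : discCoord a b = discCoord a' b')
    (h' : discCoord b a = discCoord b' a') : a = a' := by
  have hsq : a ^ 2 = a' ^ 2 := by
    refine eq_of_mul_one_sub_half_eq ha hb ha' hb' ?_ ?_
    · rw [← discCoord_sq a hb, ← discCoord_sq a' hb', h]
    · rw [← discCoord_sq b ha, ← discCoord_sq b' ha', h']
  have hsq' : b ^ 2 = b' ^ 2 := by
    refine eq_of_mul_one_sub_half_eq hb ha hb' ha' ?_ ?_
    · rw [← discCoord_sq b ha, ← discCoord_sq b' ha', h']
    · rw [← discCoord_sq a hb, ← discCoord_sq a' hb', h]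
  have hpos : 0 < √(1 - b ^ 2 / 2) := Real.sqrt_pos.2 (by linarith)
  rw [discCoord, discCoord, ← hsq'] at h
  exact mul_right_cancel₀ hpos.ne' h

theorem exists_mul_sqrt_eq {u A r : ℝ} (hr : 0 < r) (h : A * r = u ^ 2) :
    ∃ a, a ^ 2 = A ∧ a * √r = u := by
  refine ⟨u / √r, ?_, div_mul_cancel₀ u (Real.sqrt_pos.2 hr).ne'⟩
  rw [div_pow, Real.sq_sqrt hr.le, ← h, mul_div_cancel_right₀ _ hr.ne']

theorem exists_discCoord_eq {u v : ℝ} (h : u ^ 2 + v ^ 2 ≤ 1) :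
    ∃ a b, a ^ 2 ≤ 1 ∧ b ^ 2 ≤ 1 ∧ discCoord a b = u ∧ discCoord b a = v := by
  -- `A = a²` and `B = b²` solve `A (1 - B / 2) = u²`, `B (1 - A / 2) = v²`, so that `A - B = D`.
  set D := u ^ 2 - v ^ 2 with hD
  set R := √(D ^ 2 + 4 * (1 - u ^ 2 - v ^ 2))
  have hRsq : R ^ 2 = D ^ 2 + 4 * (1 - u ^ 2 - v ^ 2) := Real.sq_sqrt (by nlinarith [sq_nonneg D])
  have hle : |D| ≤ R := Real.abs_le_sqrt (by linarith)
  obtain ⟨hle₁, hle₂⟩ := abs_le.1 hle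
  obtain ⟨a, ha, hau⟩ := exists_mul_sqrt_eq (u := u) (A := (2 + D - R) / 2)
    (r := 1 - (2 - D - R) / 2 / 2) (by linarith) (by linear_combination -hRsq / 8 + hD)
  obtain ⟨b, hb, hbv⟩ := exists_mul_sqrt_eq (u := v) (A := (2 - D - R) / 2)
    (r := 1 - (2 + D - R) / 2 / 2) (by linarith) (by linear_combination -hRsq / 8 + hD)
  refine ⟨a, b, by linarith, by linarith, ?_, ?_⟩
  · rw [discCoord, hb, hau]
  · rw [discCoord, ha, hbv]

theorem cos_pi_mul (ε : ℤˣ) (t : ℝ) (b : ℤ) :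
    Real.cos (Real.pi * ((ε : ℤ) * t + b)) = (b.negOnePow : ℤ) * Real.cos (Real.pi * t) := by
  rw [mul_add, mul_comm Real.pi (b : ℝ), Real.cos_add_int_mul_pi, ← Int.cast_negOnePow]
  rcases Int.units_eq_one_or ε with rfl | rfl <;> simp

theorem sin_pi_mul (ε : ℤˣ) (t : ℝ) (b : ℤ) :
    Real.sin (Real.pi * ((ε : ℤ) * t + b)) =
      (ε : ℤ) * (b.negOnePow : ℤ) * Real.sin (Real.pi * t) := by
  rw [mul_add, mul_comm Real.pi (b : ℝ), Real.sin_add_int_mul_pi, ← Int.cast_negOnePow]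
  rcases Int.units_eq_one_or ε with rfl | rfl <;> simp

theorem exists_of_cos_pi_mul_eq {s : ℤˣ} {t u : ℝ}
    (h : Real.cos (Real.pi * u) = (s : ℤ) * Real.cos (Real.pi * t)) :
    ∃ (ε : ℤˣ) (b : ℤ), b.negOnePow = s ∧ u = (ε : ℤ) * t + b := by
  obtain ⟨e, rfl⟩ : ∃ e : ℤ, e.negOnePow = s := by
    rcases Int.units_eq_one_or s with rfl | rfl
    exacts [⟨0, rfl⟩, ⟨1, rfl⟩]
  rw [← cos_pi_mul 1 t e, Units.val_one, Int.cast_one, one_mul] at h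
  obtain ⟨k, hk | hk⟩ := Real.cos_eq_cos_iff.1 h
  · refine ⟨1, e - 2 * k, by simp [Int.negOnePow_sub], mul_left_cancel₀ Real.pi_ne_zero ?_⟩
    push_cast at hk ⊢
    linarith
  · refine ⟨-1, 2 * k - e, by simp [Int.negOnePow_sub], mul_left_cancel₀ Real.pi_ne_zero ?_⟩
    push_cast at hk ⊢
    linarith

theorem exists_neg_mul_add_of_sin_pi_mul_eq_zero {t : ℝ} (h : Real.sin (Real.pi * t) = 0) (ε : ℤˣ)
    (b : ℤ) : ∃ b' : ℤ, b'.negOnePow = b.negOnePow ∧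
      ((ε : ℤ) : ℝ) * t + b = ((-ε : ℤˣ) : ℤ) * t + b' := by
  obtain ⟨k, hk⟩ := Real.sin_eq_zero_iff.1 h
  obtain rfl : t = k := mul_left_cancel₀ Real.pi_ne_zero (by rw [← hk, mul_comm])
  refine ⟨b + 2 * (ε * k), by simp [Int.negOnePow_add], ?_⟩
  push_cast
  ring

/-- The map `ℝ³ → S²` which rolls the first two coordinates up to a pillow, the double of the square
`[-1, 1]²`, and identifies the latter with the sphere by means of the elliptical grid mapping. -/
noncomputable def pillow (x : E 3) : Metric.sphere (0 : E 3) 1 :=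
  ⟨!₂[discCoord (Real.cos (Real.pi * x 0)) (Real.cos (Real.pi * x 1)),
      discCoord (Real.cos (Real.pi * x 1)) (Real.cos (Real.pi * x 0)),
      Real.sin (Real.pi * x 0) * Real.sin (Real.pi * x 1)], by
    rw [mem_sphere_zero_iff_norm, EuclideanSpace.norm_eq, Real.sqrt_eq_one, Fin.sum_univ_three]
    simp only [Matrix.cons_val, Real.norm_eq_abs, sq_abs, mul_pow, Real.sin_sq,
      discCoord_sq _ (Real.cos_sq_le_one _)]
    ring⟩

theorem continuous_pillow : Continuous pillow := by
  refine Continuous.subtype_mk ?_ _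
  unfold discCoord
  fun_prop

theorem pillow_eq_smul_iff {s : ℤˣ} {x y : E 3} :
    (pillow y).1 = ((s : ℤ) : ℝ) • (pillow x).1 ↔
      Real.cos (Real.pi * y 0) = (s : ℤ) * Real.cos (Real.pi * x 0) ∧
      Real.cos (Real.pi * y 1) = (s : ℤ) * Real.cos (Real.pi * x 1) ∧
      Real.sin (Real.pi * y 0) * Real.sin (Real.pi * y 1) =
        (s : ℤ) * (Real.sin (Real.pi * x 0) * Real.sin (Real.pi * x 1)) := by
  have hsq (t : ℝ) : (((s : ℤ) : ℝ) * Real.cos (Real.pi * t)) ^ 2 ≤ 1 := by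
    rcases Int.units_eq_one_or s with rfl | rfl <;> simp [Real.abs_cos_le_one]
  simp only [pillow, PiLp.ext_iff, Fin.forall_fin_succ, Fin.succ_zero_eq_one, Fin.succ_one_eq_two,
    IsEmpty.forall_iff, and_true, PiLp.smul_apply, Matrix.cons_val, smul_eq_mul,
    ← discCoord_smul s s]
  constructor
  · rintro ⟨h0, h1, h2⟩
    have hle (t : ℝ) := Real.cos_sq_le_one (Real.pi * t)
    exact ⟨eq_of_discCoord_eq (hle _) (hle _) (hsq _) (hsq _) h0 h1,
      eq_of_discCoord_eq (hle _) (hle _) (hsq _) (hsq _) h1 h0, h2⟩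
  · rintro ⟨h0, h1, h2⟩
    simp only [h0, h1, h2, and_self]

theorem pillow_diag {j : Fin 4} {b : Fin 3 → ℤ} {s : ℤˣ} (h0 : (b 0).negOnePow = s)
    (h1 : (b 1).negOnePow = s) (hs : sgn j 0 * sgn j 1 = s) (x : E 3) :
    (pillow (diag j b x)).1 = ((s : ℤ) : ℝ) • (pillow x).1 := by
  simp only [pillow_eq_smul_iff, diag_apply, cos_pi_mul, sin_pi_mul, h0, h1, ← hs, true_and]
  rcases Int.units_eq_one_or (sgn j 0) with h | h <;>
    rcases Int.units_eq_one_or (sgn j 1) with h' | h' <;> simp [h, h']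

theorem exists_of_pillow_eq_smul {s : ℤˣ} {x y : E 3}
    (h : (pillow y).1 = ((s : ℤ) : ℝ) • (pillow x).1) :
    ∃ (ε₀ ε₁ : ℤˣ) (b₀ b₁ : ℤ), ε₀ * ε₁ = s ∧ b₀.negOnePow = s ∧ b₁.negOnePow = s ∧
      y 0 = (ε₀ : ℤ) * x 0 + b₀ ∧ y 1 = (ε₁ : ℤ) * x 1 + b₁ := by
  obtain ⟨h0, h1, h2⟩ := pillow_eq_smul_iff.1 h
  obtain ⟨ε₀, b₀, hb₀, hy₀⟩ := exists_of_cos_pi_mul_eq h0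
  obtain ⟨ε₁, b₁, hb₁, hy₁⟩ := exists_of_cos_pi_mul_eq h1
  by_cases hε : ε₀ * ε₁ = s
  · exact ⟨ε₀, ε₁, b₀, b₁, hε, hb₀, hb₁, hy₀, hy₁⟩
  have hε' : -(ε₀ * ε₁) = s := by rw [Int.units_ne_iff_eq_neg.1 hε, neg_neg]
  -- The third coordinate excludes the sign `-s` unless it vanishes, and then one of the two signs
  -- can be changed.
  have hzero : Real.sin (Real.pi * x 0) = 0 ∨ Real.sin (Real.pi * x 1) = 0 := by
    rw [hy₀, hy₁, sin_pi_mul, sin_pi_mul, hb₀, hb₁, ← hε'] at h2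
    rcases Int.units_eq_one_or ε₀ with rfl | rfl <;>
      rcases Int.units_eq_one_or ε₁ with rfl | rfl <;>
        simpa [self_eq_neg, neg_eq_self] using h2
  rcases hzero with h | h
  · obtain ⟨b, hb, hyb⟩ := exists_neg_mul_add_of_sin_pi_mul_eq_zero h ε₀ b₀
    exact ⟨-ε₀, ε₁, b, b₁, by rw [neg_mul, hε'], hb.trans hb₀, hb₁, hy₀.trans hyb, hy₁⟩
  · obtain ⟨b, hb, hyb⟩ := exists_neg_mul_add_of_sin_pi_mul_eq_zero h ε₁ b₁
    exact ⟨ε₀, -ε₁, b₀, b, by rw [mul_neg, hε'], hb₀, hb.trans hb₁, hy₀, hy₁.trans hyb⟩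

theorem IsGlideGroup.diag_mem (hΓ : IsGlideGroup Γ c) {j : Fin 4} {b : Fin 3 → ℤ}
    (hb : ∀ i, (b i).negOnePow = (c j i).negOnePow) : diag j b ∈ Γ := by
  have hdiv (i : Fin 3) : ∃ m, b i = 2 * m + c j i := by
    obtain ⟨m, hm⟩ := ((Int.negOnePow_eq_iff _ _).1 (hb i)).two_dvd
    exact ⟨m, by rw [← hm, sub_add_cancel]⟩
  choose m hm using hdiv
  exact (hΓ.mem_iff _).2 ⟨j, m, congrArg (diag j) (funext hm)⟩

/-- The map `ℝ³ → ℝP² × S¹` which induces the homeomorphism of the first orbifold with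
`ℝP² × S¹`. -/
noncomputable def toProjectiveCircle (x : E 3) : ProjectivePlane × Circle :=
  (Quotient.mk antipodal (pillow x), Circle.exp (Real.pi * x 2))

theorem continuous_toProjectiveCircle : Continuous toProjectiveCircle :=
  (continuous_quot_mk.comp continuous_pillow).prodMk (Circle.exp.continuous.comp (by fun_prop))

theorem toProjectiveCircle_eq_iff {x y : E 3} :
    toProjectiveCircle x = toProjectiveCircle y ↔
      (∃ s : ℤˣ, (pillow y).1 = ((s : ℤ) : ℝ) • (pillow x).1) ∧ ∃ m : ℤ, y 2 = x 2 + 2 * m := by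
  rw [toProjectiveCircle, toProjectiveCircle, Prod.mk.injEq, Quotient.eq,
    eq_comm (a := Circle.exp _), Circle.exp_eq_exp]
  refine and_congr ?_ (exists_congr fun m => ?_)
  · change (pillow x = pillow y ∨ pillow x = -pillow y) ↔ _
    constructor
    · rintro (h | h)
      exacts [⟨1, by simp [h]⟩, ⟨-1, by simp [h]⟩]
    · rintro ⟨s, hs⟩
      rcases Int.units_eq_one_or s with rfl | rfl
      · exact Or.inl (Subtype.ext (by simpa using hs.symm))
      · exact Or.inr (Subtype.ext (by simp [hs]))
  · rw [← mul_right_inj' Real.pi_ne_zero (b := y 2)]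
    ring_nf

theorem exists_sgn_eq : ∀ ε₀ ε₁ : ℤˣ, ∃ j, sgn j 0 = ε₀ ∧ sgn j 1 = ε₁ := by decide

theorem off₁_properties : ∀ j, (off₁ j 0).negOnePow = sgn j 0 * sgn j 1 ∧
    (off₁ j 1).negOnePow = sgn j 0 * sgn j 1 ∧ off₁ j 2 = 0 := by decide

theorem toProjectiveCircle_eq_iff_exists_mem_Gam₁ (x y : E 3) :
    toProjectiveCircle x = toProjectiveCircle y ↔ ∃ g ∈ Gam₁, g x = y := by
  rw [toProjectiveCircle_eq_iff]
  constructor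
  · rintro ⟨⟨s, hs⟩, m, hm⟩
    obtain ⟨ε₀, ε₁, b₀, b₁, hε, hb₀, hb₁, hy₀, hy₁⟩ := exists_of_pillow_eq_smul hs
    obtain ⟨j, rfl, rfl⟩ := exists_sgn_eq ε₀ ε₁
    obtain ⟨h0, h1, h2⟩ := off₁_properties j
    refine ⟨diag j ![b₀, b₁, 2 * m], isGlideGroup_Gam₁.diag_mem ?_, ?_⟩
    · rw [Fin.forall_fin_succ, Fin.forall_fin_two]
      exact ⟨by simp [h0, hb₀, hε], by simp [h1, hb₁, hε], by simp [h2]⟩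
    · ext i
      fin_cases i <;> simp [diag_apply, sgn_apply_two, hy₀, hy₁, hm]
  · rintro ⟨g, hg, rfl⟩
    obtain ⟨j, m, rfl⟩ := (isGlideGroup_Gam₁.mem_iff g).1 hg
    obtain ⟨h0, h1, h2⟩ := off₁_properties j
    refine ⟨⟨_, pillow_diag ?_ ?_ rfl x⟩, m 2, ?_⟩
    · rw [Int.negOnePow_add, Int.negOnePow_two_mul, one_mul, h0]
    · rw [Int.negOnePow_add, Int.negOnePow_two_mul, one_mul, h1]
    · simp [diag_apply, h2, sgn_apply_two]

theorem exists_pillow_eq (v : Metric.sphere (0 : E 3) 1) (z : ℝ) : ∃ x, pillow x = v ∧ x 2 = z := by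
  have hv : v.1 0 ^ 2 + v.1 1 ^ 2 + v.1 2 ^ 2 = 1 := by
    have := EuclideanSpace.norm_eq v.1
    rw [mem_sphere_zero_iff_norm.1 v.2, eq_comm, Real.sqrt_eq_one, Fin.sum_univ_three] at this
    simpa only [Real.norm_eq_abs, sq_abs] using this
  obtain ⟨a, b, ha, hb, h0, h1⟩ : ∃ a b, a ^ 2 ≤ 1 ∧ b ^ 2 ≤ 1 ∧ discCoord a b = v.1 0 ∧
    discCoord b a = v.1 1 := exists_discCoord_eq (by linarith [sq_nonneg (v.1 2)])
  have hcos {t : ℝ} (ht : t ^ 2 ≤ 1) : ∃ u, Real.cos (Real.pi * u) = t := by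
    obtain ⟨hl, hu⟩ := abs_le.1 ((sq_le_one_iff_abs_le_one t).1 ht)
    exact ⟨Real.arccos t / Real.pi,
      by rw [mul_div_cancel₀ _ Real.pi_ne_zero, Real.cos_arccos hl hu]⟩
  obtain ⟨p, rfl⟩ := hcos ha
  obtain ⟨q, rfl⟩ := hcos hb
  have hsq : (Real.sin (Real.pi * p) * Real.sin (Real.pi * q)) ^ 2 = v.1 2 ^ 2 := by
    rw [← eq_sub_iff_add_eq'] at hv
    rw [hv, ← h0, ← h1, discCoord_sq _ ha, discCoord_sq _ hb, mul_pow, Real.sin_sq, Real.sin_sq]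
    ring
  rcases sq_eq_sq_iff_eq_or_eq_neg.1 hsq with hs | hs
  · refine ⟨!₂[p, q, z], Subtype.ext (PiLp.ext fun i => ?_), rfl⟩
    fin_cases i <;> simp [pillow, h0, h1, hs]
  · refine ⟨!₂[-p, q, z], Subtype.ext (PiLp.ext fun i => ?_), rfl⟩
    fin_cases i <;> simp [pillow, h0, h1, hs]

theorem surjective_toProjectiveCircle : Function.Surjective toProjectiveCircle := by
  rintro ⟨⟨v⟩, c⟩
  obtain ⟨x, hx, hx2⟩ := exists_pillow_eq v (Complex.arg c / Real.pi)
  refine ⟨x, Prod.ext (congrArg (Quotient.mk antipodal) hx) ?_⟩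
  rw [toProjectiveCircle, hx2, mul_div_cancel₀ _ Real.pi_ne_zero, Circle.exp_arg]

theorem nonempty_homeomorph_projectivePlane_prod_circle :
    Nonempty (OrbitSpace Gam₁ ≃ₜ ProjectivePlane × Circle) := by
  have := compactSpace_orbitSpace isCompact_box isGlideGroup_Gam₁.exists_apply_mem_box
  exact nonempty_homeomorph_of_eq_iff continuous_toProjectiveCircle surjective_toProjectiveCircle
    toProjectiveCircle_eq_iff_exists_mem_Gam₁

/-! ### Isometries of the flat torus -/

section Torus

variable {n : ℕ} {Λ : AddSubgroup (E n)} {Γ : Subgroup (E n ≃ᵢ E n)} {g g' : E n ≃ᵢ E n}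

theorem Induces.unique {h k : Torus Λ ≃ᵢ Torus Λ} (hh : Induces g h) (hk : Induces g k) :
    h = k := by
  ext p
  obtain ⟨x, rfl⟩ := QuotientAddGroup.mk_surjective p
  rw [hh, hk]

theorem Induces.mul {h h' : Torus Λ ≃ᵢ Torus Λ} (hh : Induces g h) (hh' : Induces g' h') :
    Induces (g * g') (h * h') := fun x => by
  rw [IsometryEquiv.mul_apply, hh', hh, IsometryEquiv.mul_apply]

theorem Induces.of_neg_add_mem {h : Torus Λ ≃ᵢ Torus Λ} (hh : Induces g h)
    (hgg' : ∀ x, -g x + g' x ∈ Λ) : Induces g' h := fun x => by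
  rw [hh, QuotientAddGroup.eq]
  exact hgg' x

theorem finite_setOf_induces {ι : Type*} [Finite ι] (f : ι → E n ≃ᵢ E n) :
    {h : Torus Λ ≃ᵢ Torus Λ | ∃ i, Induces (f i) h}.Finite := by
  rw [Set.ofPred_exists]
  exact Set.finite_iUnion fun i => Set.Subsingleton.finite fun _ hh _ hk => Induces.unique hh hk

theorem inducedGroup_mono {Γ' : Subgroup (E n ≃ᵢ E n)} (h : Γ ≤ Γ') :
    inducedGroup Λ Γ ≤ inducedGroup Λ Γ' := fun _ ⟨g, hg, hgk⟩ => ⟨g, h hg, hgk⟩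

theorem exists_dist_lt_of_dist_lt {p q : Torus Λ} {r : ℝ} (h : dist p q < r) :
    ∃ x y : E n, QuotientAddGroup.mk x = p ∧ QuotientAddGroup.mk y = q ∧ dist x y < r := by
  rw [dist_eq_norm, QuotientAddGroup.norm_lt_iff] at h
  obtain ⟨w, hw, hwr⟩ := h
  obtain ⟨y, rfl⟩ := QuotientAddGroup.mk_surjective q
  exact ⟨w + y, y, by rw [QuotientAddGroup.mk_add, hw, sub_add_cancel], rfl,
    by rwa [dist_eq_norm, add_sub_cancel_right]⟩

theorem dist_mk_le (x y : E n) :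
    dist (QuotientAddGroup.mk x : Torus Λ) (QuotientAddGroup.mk y) ≤ dist x y := by
  rw [dist_eq_norm, ← QuotientAddGroup.mk_sub, dist_eq_norm]
  exact QuotientAddGroup.norm_mk_le_norm

theorem dist_mk_eq {r : ℝ} (hr : ∀ v ∈ Λ, v ≠ 0 → 2 * r ≤ ‖v‖) {x y : E n} (hxy : dist x y ≤ r) :
    dist (QuotientAddGroup.mk x : Torus Λ) (QuotientAddGroup.mk y) = dist x y := by
  refine le_antisymm (dist_mk_le x y) ?_
  rw [dist_eq_norm] at hxy ⊢
  rw [dist_eq_norm, ← QuotientAddGroup.mk_sub, QuotientAddGroup.le_norm_iff]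
  intro w hw
  rcases eq_or_ne (-w + (x - y)) 0 with h0 | h0
  · rw [neg_add_eq_zero.1 h0]
  · have h1 := hr _ (QuotientAddGroup.eq.1 hw) h0
    have h2 := norm_add_le (-w) (x - y)
    rw [norm_neg] at h2
    linarith

/-- The isometry `g` permutes the cosets of `Λ`, and therefore acts on the torus. -/
def MapsCosets (Λ : AddSubgroup (E n)) (g : E n ≃ᵢ E n) : Prop :=
  ∀ x y, -x + y ∈ Λ → -g x + g y ∈ Λ

/-- The map of the torus induced by `g`. -/
noncomputable def MapsCosets.map (hg : MapsCosets Λ g) : Torus Λ → Torus Λ :=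
  Quotient.map' g fun x y hxy => by
    rw [QuotientAddGroup.leftRel_apply] at hxy ⊢
    exact hg x y hxy

theorem MapsCosets.map_mk (hg : MapsCosets Λ g) (x : E n) :
    hg.map (QuotientAddGroup.mk x) = QuotientAddGroup.mk (g x) := rfl

theorem MapsCosets.dist_map_le (hg : MapsCosets Λ g) (p q : Torus Λ) :
    dist (hg.map p) (hg.map q) ≤ dist p q := by
  refine le_of_forall_gt fun r hr => ?_
  obtain ⟨x, y, rfl, rfl, hxy⟩ := exists_dist_lt_of_dist_lt hr
  exact (dist_mk_le (g x) (g y)).trans_lt (by rwa [g.dist_eq])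

theorem MapsCosets.exists_induces (hg : MapsCosets Λ g) (hg' : MapsCosets Λ g⁻¹) :
    ∃ h : Torus Λ ≃ᵢ Torus Λ, Induces g h := by
  have hleft : Function.LeftInverse hg'.map hg.map := by
    intro p
    obtain ⟨x, rfl⟩ := QuotientAddGroup.mk_surjective p
    rw [hg.map_mk, hg'.map_mk, IsometryEquiv.inv_apply_self]
  have hright : Function.RightInverse hg'.map hg.map := by
    intro p
    obtain ⟨x, rfl⟩ := QuotientAddGroup.mk_surjective p
    rw [hg'.map_mk, hg.map_mk, IsometryEquiv.apply_inv_self]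
  refine ⟨⟨⟨hg.map, hg'.map, hleft, hright⟩, Isometry.of_dist_eq fun p q => ?_⟩, fun x => rfl⟩
  refine le_antisymm (hg.dist_map_le p q) ?_
  calc dist p q = dist (hg'.map (hg.map p)) (hg'.map (hg.map q)) := by rw [hleft, hleft]
    _ ≤ _ := hg'.dist_map_le _ _

/-- The group of translations by the vectors of a lattice, whose quotient is the flat torus. -/
def translGroup (Λ : AddSubgroup (E n)) : Subgroup (E n ≃ᵢ E n) where
  carrier := {g | ∃ v ∈ Λ, g = transl v}
  one_mem' := ⟨0, Λ.zero_mem, IsometryEquiv.ext fun x => (add_zero x).symm⟩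
  mul_mem' := by
    rintro _ _ ⟨v, hv, rfl⟩ ⟨w, hw, rfl⟩
    exact ⟨w + v, Λ.add_mem hw hv, IsometryEquiv.ext fun x => add_assoc x w v⟩
  inv_mem' := by
    rintro _ ⟨v, hv, rfl⟩
    refine ⟨-v, Λ.neg_mem hv, IsometryEquiv.ext fun x => (transl v).injective ?_⟩
    rw [IsometryEquiv.apply_inv_self, transl_apply, transl_apply, neg_add_cancel_right]

theorem proj_inducedGroup_eq_iff (hΛ : translGroup Λ ≤ Γ)
    (hΓ : ∀ g ∈ Γ, ∃ h : Torus Λ ≃ᵢ Torus Λ, Induces g h) (x y : E n) :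
    proj (inducedGroup Λ Γ) (QuotientAddGroup.mk x) =
      proj (inducedGroup Λ Γ) (QuotientAddGroup.mk y) ↔ ∃ g ∈ Γ, g x = y := by
  rw [proj_eq_proj_iff]
  constructor
  · rintro ⟨h, ⟨g, hg, hgh⟩, hxy⟩
    rw [hgh, QuotientAddGroup.eq] at hxy
    refine ⟨transl (-g x + y) * g, Γ.mul_mem (hΛ ⟨_, hxy, rfl⟩) hg, ?_⟩
    rw [IsometryEquiv.mul_apply, transl_apply, add_neg_cancel_left]
  · rintro ⟨g, hg, rfl⟩
    obtain ⟨h, hgh⟩ := hΓ g hg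
    exact ⟨h, ⟨g, hg, hgh⟩, hgh x⟩

theorem orbifoldIsometric_inducedGroup (hΛ : translGroup Λ ≤ Γ)
    (hΓ : ∀ g ∈ Γ, ∃ h : Torus Λ ≃ᵢ Torus Λ, Induces g h) {r : ℝ} (hr0 : 0 < r)
    (hr : ∀ v ∈ Λ, v ≠ 0 → 2 * r ≤ ‖v‖) : OrbifoldIsometric Γ (inducedGroup Λ Γ) := by
  have hmk : IsOpenQuotientMap (QuotientAddGroup.mk : E n → Torus Λ) :=
    QuotientAddGroup.isOpenQuotientMap_mk
  obtain ⟨F, hF⟩ := exists_homeomorph_of_eq_iff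
    ((isOpenQuotientMap_proj (Γ := inducedGroup Λ Γ)).comp hmk) (proj_inducedGroup_eq_iff hΛ hΓ)
  refine ⟨F, fun x => ?_⟩
  have hdist : ∀ y ∈ Metric.ball x (r / 2), ∀ z ∈ Metric.ball x (r / 2),
      dist (QuotientAddGroup.mk y : Torus Λ) (QuotientAddGroup.mk z) = dist y z := by
    intro y hy z hz
    refine dist_mk_eq hr ?_
    rw [Metric.mem_ball] at hy hz
    linarith [dist_triangle_right y z x]
  have hinj : Set.InjOn (QuotientAddGroup.mk : E n → Torus Λ) (Metric.ball x (r / 2)) := by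
    intro y hy z hz hyz
    rw [← dist_eq_zero, ← hdist y hy z hz, hyz, dist_self]
  exact ⟨OpenPartialHomeomorph.ofContinuousOpen (hinj.toPartialEquiv _ _)
    hmk.continuous.continuousOn hmk.isOpenMap Metric.isOpen_ball,
    Metric.mem_ball_self (by linarith), hdist, fun y _ => congrFun hF y⟩

end Torus

/-- The group of all signed permutations of the coordinates composed with translations by vectors of
`Λ / 4`. -/
noncomputable def signedGroup : Subgroup (E 3 ≃ᵢ E 3) where
  carrier := {g | ∃ σ ε, ∃ m : Fin 3 → ℤ, g = signedPerm σ ε fun i => m i / 2}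
  one_mem' := ⟨1, 1, 0, by rw [← signedPerm_one_one_zero]; congr; funext i; simp⟩
  mul_mem' := by
    rintro _ _ ⟨σ, ε, m, rfl⟩ ⟨τ, δ, k, rfl⟩
    refine ⟨τ * σ, fun i => ε i * δ (σ i), fun i => ε i * k (σ i) + m i, ?_⟩
    rw [signedPerm_mul]
    congr! 2 with i
    push_cast
    ring
  inv_mem' := by
    rintro _ ⟨σ, ε, m, rfl⟩
    refine ⟨σ⁻¹, fun i => ε (σ⁻¹ i), fun i => -(ε (σ⁻¹ i) * m (σ⁻¹ i)), ?_⟩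
    rw [signedPerm_inv]
    congr! 2 with i
    push_cast
    ring

theorem mapsCosets_of_mem_signedGroup {g : E 3 ≃ᵢ E 3} (hg : g ∈ signedGroup) :
    MapsCosets Lam g := by
  obtain ⟨σ, ε, m, rfl⟩ := hg
  intro x y hxy i
  obtain ⟨k, hk⟩ := hxy (σ i)
  refine ⟨ε i * k, ?_⟩
  simp only [PiLp.add_apply, PiLp.neg_apply, signedPerm_apply] at hk ⊢
  push_cast
  linear_combination ((ε i : ℤ) : ℝ) * hk

theorem exists_induces_of_mem_signedGroup {g : E 3 ≃ᵢ E 3} (hg : g ∈ signedGroup) :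
    ∃ h : Torus Lam ≃ᵢ Torus Lam, Induces g h :=
  (mapsCosets_of_mem_signedGroup hg).exists_induces
    (mapsCosets_of_mem_signedGroup (signedGroup.inv_mem hg))

theorem finite_inducedGroup_signedGroup :
    (inducedGroup Lam signedGroup : Set (Torus Lam ≃ᵢ Torus Lam)).Finite := by
  refine (finite_setOf_induces
    fun d : Equiv.Perm (Fin 3) × (Fin 3 → ℤˣ) × (Fin 3 → ZMod 4) =>
      signedPerm d.1 d.2.1 fun i => ((d.2.2 i).val : ℝ) / 2).subset ?_
  rintro h ⟨_, ⟨σ, ε, m, rfl⟩, hh⟩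
  refine ⟨(σ, ε, fun i => (m i : ZMod 4)), hh.of_neg_add_mem fun x i => ⟨-(m i / 4), ?_⟩⟩
  have hval : (((m i : ZMod 4).val : ℤ) : ℝ) = m i - 4 * (m i / 4 : ℤ) := by
    have := Int.mul_ediv_add_emod (m i) 4
    rw [ZMod.val_intCast]
    exact_mod_cast (eq_sub_iff_add_eq'.2 this)
  rw [Int.cast_natCast] at hval
  simp only [PiLp.add_apply, PiLp.neg_apply, signedPerm_apply, hval]
  push_cast
  ring

theorem mem_permSet_iff {g : E 3 ≃ᵢ E 3} :
    g ∈ permSet ↔ ∃ σ, ∃ m : Fin 3 → ℤ, g = signedPerm σ 1 fun i => m i / 2 := by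
  constructor
  · rintro ⟨B, b, ⟨σ, hB⟩, hb, rfl⟩
    choose m hm using hb
    refine ⟨σ, fun i => m (σ i), (ortho_mul_transl_eq_signedPerm hB b).trans ?_⟩
    congr! 2 with i
    have := hm (σ i)
    rw [PiLp.smul_apply, smul_eq_mul] at this
    linarith
  · rintro ⟨σ, m, rfl⟩
    have hσ : σ.permMatrix ℝ ∈ Matrix.orthogonalGroup (Fin 3) ℝ := by
      rw [Matrix.mem_orthogonalGroup_iff, Matrix.transpose_permMatrix, ← Matrix.permMatrix_mul]
      simp
    refine ⟨⟨_, hσ⟩, WithLp.toLp 2 fun i => m (σ⁻¹ i) / 2, ⟨σ, rfl⟩, fun i => ⟨m (σ⁻¹ i), ?_⟩, ?_⟩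
    · rw [PiLp.smul_apply, smul_eq_mul]
      ring
    · rw [ortho_mul_transl_eq_signedPerm rfl]
      congr! 2 with i
      simp

theorem permSet_subset_signedGroup : permSet ⊆ signedGroup := by
  intro g hg
  obtain ⟨σ, m, hg⟩ := mem_permSet_iff.1 hg
  exact ⟨σ, 1, m, hg⟩

theorem IsGlideGroup.le_signedGroup (hΓ : IsGlideGroup Γ c) : Γ ≤ signedGroup := by
  intro g hg
  obtain ⟨j, m, rfl⟩ := (hΓ.mem_iff g).1 hg
  refine ⟨1, sgn j, fun i => 2 * (2 * m i + c j i), ?_⟩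
  rw [diag]
  congr! 2 with i
  push_cast
  ring

theorem exists_induces_of_mem {g : E 3 ≃ᵢ E 3}
    (hg : g ∈ (Gam₁ : Set (E 3 ≃ᵢ E 3)) ∪ Gam₂ ∪ permSet) :
    ∃ h : Torus Lam ≃ᵢ Torus Lam, Induces g h :=
  exists_induces_of_mem_signedGroup <| Set.union_subset
    (Set.union_subset isGlideGroup_Gam₁.le_signedGroup isGlideGroup_Gam₂.le_signedGroup)
    permSet_subset_signedGroup hg

theorem bigGroup_le : bigGroup ≤ inducedGroup Lam signedGroup :=
  (Subgroup.closure_le _).2 <| Set.union_subset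
    (Set.union_subset (inducedGroup_mono isGlideGroup_Gam₁.le_signedGroup)
      (inducedGroup_mono isGlideGroup_Gam₂.le_signedGroup))
    fun _ ⟨g, hg, hgh⟩ => ⟨g, permSet_subset_signedGroup hg, hgh⟩

theorem finite_bigGroup : Finite bigGroup :=
  (finite_inducedGroup_signedGroup.subset bigGroup_le).to_subtype

theorem IsGlideGroup.translGroup_le (hΓ : IsGlideGroup Γ c) : translGroup Lam ≤ Γ := by
  rintro _ ⟨v, hv, rfl⟩
  choose m hm using hv
  refine (hΓ.mem_iff _).2 ⟨0, m, ?_⟩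
  rw [transl_eq_signedPerm, diag, hΓ.zero]
  congr! 1
  · decide
  · funext i
    simp [hm]

theorem two_le_norm_of_mem_Lam {v : E 3} (hv : v ∈ Lam) (h0 : v ≠ 0) : 2 ≤ ‖v‖ := by
  obtain ⟨i, hi⟩ : ∃ i, v i ≠ 0 := by
    by_contra! h
    exact h0 (PiLp.ext h)
  obtain ⟨m, hm⟩ := hv i
  have hm0 : m ≠ 0 := by
    rintro rfl
    exact hi (by rw [hm, Int.cast_zero, mul_zero])
  have hm1 : (1 : ℝ) ≤ |(m : ℝ)| := by exact_mod_cast Int.one_le_abs hm0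
  calc (2 : ℝ) ≤ 2 * |(m : ℝ)| := by linarith
    _ = ‖v i‖ := by rw [hm, norm_mul, Real.norm_ofNat, Real.norm_eq_abs]
    _ ≤ ‖v‖ := PiLp.norm_apply_le v i

theorem IsGlideGroup.exists_induces (hΓ : IsGlideGroup Γ c) {g : E 3 ≃ᵢ E 3} (hg : g ∈ Γ) :
    ∃ h : Torus Lam ≃ᵢ Torus Lam, Induces g h :=
  exists_induces_of_mem_signedGroup (hΓ.le_signedGroup hg)

theorem IsGlideGroup.orbifoldIsometric (hΓ : IsGlideGroup Γ c) :
    OrbifoldIsometric Γ (inducedGroup Lam Γ) :=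
  orbifoldIsometric_inducedGroup hΓ.translGroup_le
    (fun _ hg => hΓ.exists_induces hg) one_pos
    fun _ hv h0 => (mul_one (2 : ℝ)).trans_le (two_le_norm_of_mem_Lam hv h0)

theorem rho_mem_rhoSet (b : Fin 4 → E 3) (j : Fin 4) : rho b j ∈ rhoSet b :=
  ⟨j, 0, Lam.zero_mem, IsometryEquiv.ext fun x => by
    rw [IsometryEquiv.mul_apply, transl_apply, add_zero]⟩

theorem coe_inducedGroup_eq {b : Fin 4 → E 3} (hΓ : (Γ : Set (E 3 ≃ᵢ E 3)) = rhoSet b) :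
    (inducedGroup Lam Γ : Set (Torus Lam ≃ᵢ Torus Lam)) = {h | ∃ j, Induces (rho b j) h} := by
  ext h
  constructor
  · rintro ⟨g, hg, hgh⟩
    rw [← SetLike.mem_coe, hΓ] at hg
    obtain ⟨j, v, hv, rfl⟩ := hg
    refine ⟨j, fun x => ?_⟩
    have : (QuotientAddGroup.mk x : Torus Lam) = QuotientAddGroup.mk (x + -v) := by
      rw [QuotientAddGroup.eq, neg_add_cancel_left]
      exact Lam.neg_mem hv
    rw [this, hgh, IsometryEquiv.mul_apply, transl_apply, neg_add_cancel_right]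
  · rintro ⟨j, hj⟩
    exact ⟨rho b j, hΓ.ge (rho_mem_rhoSet b j), hj⟩

theorem rho_eq_diag {b : Fin 4 → E 3} (hb : ∀ j i, b j i = c j i) (j : Fin 4) :
    rho b j = diag j fun i => sgn j i * c j i := by
  have h := rho_mul_transl_eq_diag hb (v := 0) (m := 0) (fun i => by simp) j
  rw [transl_eq_signedPerm, WithLp.ofLp_zero, signedPerm_one_one_zero, mul_one] at h
  simpa only [Pi.zero_apply, mul_zero, zero_add] using h

theorem eq_of_induces_diag {h : Torus Lam ≃ᵢ Torus Lam} {j k : Fin 4} {a b : Fin 3 → ℤ}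
    (hj : Induces (diag j a) h) (hk : Induces (diag k b) h) : j = k := by
  refine sgn_injective (funext fun i => ?_)
  -- The generic point `(1/4, 1/4, 1/4)` tells the signs apart.
  obtain ⟨m, hm⟩ := QuotientAddGroup.eq.1
    ((hj (WithLp.toLp 2 fun _ => 1 / 4)).symm.trans (hk (WithLp.toLp 2 fun _ => 1 / 4))) i
  simp only [PiLp.add_apply, PiLp.neg_apply, diag_apply] at hm
  have hm' : (-(sgn j i + 4 * a i) + (sgn k i + 4 * b i) : ℤ) = 8 * m := by
    rify
    linear_combination 4 * hm
  rcases Int.units_eq_one_or (sgn j i) with hji | hji <;>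
    rcases Int.units_eq_one_or (sgn k i) with hki | hki <;>
    simp only [hji, hki, Units.val_neg, Units.val_one] at hm' ⊢ <;> omega

theorem IsGlideGroup.exists_range_eq_inducedGroup (hΓ : IsGlideGroup Γ c) {b : Fin 4 → E 3}
    (hb : ∀ j i, b j i = c j i) : ∃ r : Fin 4 → (Torus Lam ≃ᵢ Torus Lam),
      Function.Injective r ∧ (∀ j, Induces (rho b j) (r j)) ∧
        (inducedGroup Lam Γ : Set (Torus Lam ≃ᵢ Torus Lam)) = Set.range r := by
  have hcoe := hΓ.coe_eq_rhoSet hb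
  choose r hr using fun j => hΓ.exists_induces (hcoe.ge (rho_mem_rhoSet b j))
  refine ⟨r, fun j k hjk => ?_, hr, ?_⟩
  · have hj := hr j
    have hk := hr k
    rw [rho_eq_diag hb] at hj hk
    exact eq_of_induces_diag hj (hjk ▸ hk)
  · rw [coe_inducedGroup_eq hcoe]
    ext h
    exact ⟨fun ⟨j, hj⟩ => ⟨j, (hr j).unique hj⟩, fun ⟨j, hj⟩ => ⟨j, hj ▸ hr j⟩⟩

theorem almostConjugate_of_range {G : Type*} [Group G] {H₁ H₂ : Subgroup G} {ι : Type*} [Finite ι]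
    {r₁ r₂ : ι → G} (h₁ : Function.Injective r₁) (h₂ : Function.Injective r₂)
    (e₁ : (H₁ : Set G) = Set.range r₁) (e₂ : (H₂ : Set G) = Set.range r₂)
    (h : ∀ i, IsConj (r₁ i) (r₂ i)) : AlmostConjugate H₁ H₂ := by
  refine ⟨?_, ?_, fun b => ?_⟩
  · exact (e₁ ▸ Set.finite_range r₁ : (H₁ : Set G).Finite).to_subtype
  · exact (e₂ ▸ Set.finite_range r₂ : (H₂ : Set G).Finite).to_subtype
  · rw [e₁, e₂, ← Set.image_preimage_eq_inter_range, ← Set.image_preimage_eq_inter_range,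
      Set.ncard_image_of_injective _ h₁, Set.ncard_image_of_injective _ h₂]
    congr 1
    ext i
    exact ⟨fun hi => IsConj.trans hi (h i), fun hi => IsConj.trans hi (h i).symm⟩

theorem almostConjugate_subgroupOf {K : Type*} [Group K] {G H₁ H₂ : Subgroup K} {ι : Type*}
    [Finite ι] {r₁ r₂ : ι → K} (h₁ : Function.Injective r₁) (h₂ : Function.Injective r₂)
    (e₁ : (H₁ : Set K) = Set.range r₁) (e₂ : (H₂ : Set K) = Set.range r₂) (hG₁ : H₁ ≤ G)
    (hG₂ : H₂ ≤ G) (h : ∀ i, ∃ k ∈ G, k * r₁ i = r₂ i * k) :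
    AlmostConjugate (H₁.subgroupOf G) (H₂.subgroupOf G) := by
  have hmem₁ (i : ι) : r₁ i ∈ G := hG₁ (e₁.ge ⟨i, rfl⟩)
  have hmem₂ (i : ι) : r₂ i ∈ G := hG₂ (e₂.ge ⟨i, rfl⟩)
  refine almostConjugate_of_range (r₁ := fun i => (⟨r₁ i, hmem₁ i⟩ : G))
    (r₂ := fun i => (⟨r₂ i, hmem₂ i⟩ : G)) (fun i j hij => h₁ (congrArg Subtype.val hij))
    (fun i j hij => h₂ (congrArg Subtype.val hij)) ?_ ?_ fun i => ?_
  · ext k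
    simp only [Subgroup.coe_subgroupOf, e₁, Set.mem_preimage, Set.mem_range, Subgroup.subtype_apply,
      Subtype.ext_iff]
  · ext k
    simp only [Subgroup.coe_subgroupOf, e₂, Set.mem_preimage, Set.mem_range, Subgroup.subtype_apply,
      Subtype.ext_iff]
  · obtain ⟨k, hk, hki⟩ := h i
    exact isConj_iff.2 ⟨⟨k, hk⟩, mul_inv_eq_iff_eq_mul.2 (Subtype.ext hki)⟩

/-- Isometries conjugating `ρ_j` to `ρ'_j`: for odd `j`, a coordinate in which `ρ_j` acts as a unit
translation is exchanged with the third one, and the reflection hyperplane is shifted to `0`. -/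
noncomputable def conjIsom (j : Fin 4) : E 3 ≃ᵢ E 3 :=
  signedPerm ((![1, Equiv.swap 1 2, 1, Equiv.swap 0 2] : Fin 4 → Equiv.Perm (Fin 3)) j) 1
    fun i => ((![0, ![1, 0, 0], 0, ![0, 1, 0]] : Fin 4 → Fin 3 → ℤ) j i : ℝ) / 2

theorem conjIsom_mem (j : Fin 4) : conjIsom j ∈ permSet := mem_permSet_iff.2 ⟨_, _, rfl⟩

theorem conjIsom_mul_rho (j : Fin 4) :
    conjIsom j * rho trans₁ j = rho trans₂ j * conjIsom j := by
  rw [rho_eq_diag trans₁_apply, rho_eq_diag trans₂_apply]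
  ext x i
  fin_cases j <;> fin_cases i <;>
    simp [conjIsom, signedPerm_apply, diag_apply, sgn, off₁, off₂, Equiv.swap_apply_def] <;> ring

theorem inducedGroup_Gam₁_le : inducedGroup Lam Gam₁ ≤ bigGroup := fun _ hh =>
  Subgroup.subset_closure (Or.inl (Or.inl hh))

theorem inducedGroup_Gam₂_le : inducedGroup Lam Gam₂ ≤ bigGroup := fun _ hh =>
  Subgroup.subset_closure (Or.inl (Or.inr hh))

theorem almostConjugate_inducedGroup :
    AlmostConjugate ((inducedGroup Lam Gam₁).subgroupOf bigGroup)
      ((inducedGroup Lam Gam₂).subgroupOf bigGroup) := by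
  obtain ⟨r₁, hinj₁, hr₁, e₁⟩ := isGlideGroup_Gam₁.exists_range_eq_inducedGroup trans₁_apply
  obtain ⟨r₂, hinj₂, hr₂, e₂⟩ := isGlideGroup_Gam₂.exists_range_eq_inducedGroup trans₂_apply
  refine almostConjugate_subgroupOf hinj₁ hinj₂ e₁ e₂ inducedGroup_Gam₁_le inducedGroup_Gam₂_le
    fun j => ?_
  obtain ⟨k, hk⟩ := exists_induces_of_mem_signedGroup (permSet_subset_signedGroup (conjIsom_mem j))
  refine ⟨k, Subgroup.subset_closure (Or.inr ⟨_, conjIsom_mem j, hk⟩), ?_⟩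
  exact (conjIsom_mul_rho j ▸ hk.mul (hr₁ j)).unique ((hr₂ j).mul hk)

/-! ### Singular sets -/

section OrbitSpace

variable {M N : Type*} [PseudoMetricSpace M] [PseudoMetricSpace N] {Γ : Subgroup (M ≃ᵢ M)}
  {Γ' : Subgroup (N ≃ᵢ N)}

/-- The orbits of `Γ` are closed and discrete. -/
def HasClosedDiscreteOrbits (Γ : Subgroup (M ≃ᵢ M)) : Prop :=
  ∀ x y : M, ∃ ε > 0, ∀ g ∈ Γ, dist (g x) y < ε → g x = y

theorem HasClosedDiscreteOrbits.exists_forall_mem_ball (h : HasClosedDiscreteOrbits Γ) (x y : M) :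
    ∃ ε > 0, ∀ a ∈ Metric.ball x ε, ∀ g ∈ Γ, g a ∈ Metric.ball y ε → g x = y := by
  obtain ⟨ε, hε, hxy⟩ := h x y
  refine ⟨ε / 2, half_pos hε, fun a ha g hg hga => hxy g hg ?_⟩
  rw [Metric.mem_ball'] at ha
  rw [Metric.mem_ball] at hga
  calc dist (g x) y ≤ dist (g x) (g a) + dist (g a) y := dist_triangle _ _ _
    _ < ε / 2 + ε / 2 := add_lt_add (by rwa [g.dist_eq]) hga
    _ = ε := add_halves ε

theorem HasClosedDiscreteOrbits.t2Space_orbitSpace (h : HasClosedDiscreteOrbits Γ) :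
    T2Space (OrbitSpace Γ) := by
  refine ⟨fun p q hpq => ?_⟩
  obtain ⟨x, rfl⟩ := isOpenQuotientMap_proj.surjective p
  obtain ⟨y, rfl⟩ := isOpenQuotientMap_proj.surjective q
  obtain ⟨ε, hε, hxy⟩ := h.exists_forall_mem_ball x y
  refine ⟨proj Γ '' Metric.ball x ε, proj Γ '' Metric.ball y ε,
    isOpenQuotientMap_proj.isOpenMap _ Metric.isOpen_ball,
    isOpenQuotientMap_proj.isOpenMap _ Metric.isOpen_ball,
    ⟨x, Metric.mem_ball_self hε, rfl⟩, ⟨y, Metric.mem_ball_self hε, rfl⟩, Set.disjoint_left.2 ?_⟩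
  rintro _ ⟨a, ha, rfl⟩ ⟨b, hb, hab⟩
  obtain ⟨g, hg, rfl⟩ := proj_eq_proj_iff.1 hab.symm
  exact hpq (proj_eq_proj_iff.2 ⟨g, hg, hxy a ha g hg hb⟩)

/-- The projection to the orbit space is injective near `x`. For the groups of the example, this
topological condition singles out the regular points, which makes the singular set an invariant. -/
def LocallyInjectiveAt (Γ : Subgroup (M ≃ᵢ M)) (x : M) : Prop :=
  ∃ U ∈ nhds x, Set.InjOn (proj Γ) U

theorem HasClosedDiscreteOrbits.locallyInjectiveAt (h : HasClosedDiscreteOrbits Γ) {x : M}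
    (hx : isotropy Γ x = ⊥) : LocallyInjectiveAt Γ x := by
  obtain ⟨ε, hε, hxx⟩ := h.exists_forall_mem_ball x x
  refine ⟨Metric.ball x ε, Metric.ball_mem_nhds _ hε, fun a ha b hb hab => ?_⟩
  obtain ⟨g, hg, rfl⟩ := proj_eq_proj_iff.1 hab
  have hmem : (⟨g, hg⟩ : Γ) ∈ isotropy Γ x := hxx a ha g hg hb
  rw [hx, Subgroup.mem_bot] at hmem
  rw [show g = 1 from congrArg Subtype.val hmem, IsometryEquiv.coe_one, id]

theorem locallyInjectiveAt_iff_of_lift {f : OrbitSpace Γ ≃ₜ OrbitSpace Γ'} {x : M}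
    {φ : OpenPartialHomeomorph M N} (hx : x ∈ φ.source)
    (hφ : ∀ y ∈ φ.source, f (proj Γ y) = proj Γ' (φ y)) :
    LocallyInjectiveAt Γ x ↔ LocallyInjectiveAt Γ' (φ x) := by
  constructor
  · rintro ⟨U, hU, hinj⟩
    refine ⟨φ '' (φ.source ∩ U), φ.image_mem_nhds hx
      (Filter.inter_mem (φ.open_source.mem_nhds hx) hU), ?_⟩
    rintro _ ⟨a, ⟨ha, haU⟩, rfl⟩ _ ⟨b, ⟨hb, hbU⟩, rfl⟩ hab
    rw [← hφ a ha, ← hφ b hb] at hab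
    rw [hinj haU hbU (f.injective hab)]
  · rintro ⟨V, hV, hinj⟩
    refine ⟨φ.source ∩ φ ⁻¹' V, Filter.inter_mem (φ.open_source.mem_nhds hx)
      ((φ.continuousAt hx).preimage_mem_nhds hV), ?_⟩
    rintro a ⟨ha, haV⟩ b ⟨hb, hbV⟩ hab
    refine φ.injOn ha hb (hinj haV hbV ?_)
    rw [← hφ a ha, ← hφ b hb, hab]

/-- The invariant map `f` bounds the quotient distance from below, and `γ` attains the bound. -/
theorem orbitDist_proj_eq_dist {ℓ : ℝ} {γ : ℝ → M} {f : M → AddCircle ℓ} (hf : LipschitzWith 1 f)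
    (hfΓ : ∀ g ∈ Γ, ∀ x, f (g x) = f x) (hγ : Isometry γ) (hfγ : ∀ t, f (γ t) = t)
    (hper : Function.Periodic (fun t => proj Γ (γ t)) ℓ) (s t : ℝ) :
    orbitDist Γ (proj Γ (γ s)) (proj Γ (γ t)) = dist (s : AddCircle ℓ) t := by
  refine IsLeast.csInf_eq ⟨?_, ?_⟩
  · refine ⟨γ s, γ (t + round (ℓ⁻¹ * (s - t)) * ℓ), rfl, hper.int_mul _ t, ?_⟩
    rw [hγ.dist_eq, Real.dist_eq, dist_eq_norm, ← AddCircle.coe_sub, AddCircle.norm_eq, sub_sub]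
  · rintro _ ⟨x, y, hx, hy, rfl⟩
    obtain ⟨g, hg, rfl⟩ := proj_eq_proj_iff.1 hx.symm
    obtain ⟨h, hh, rfl⟩ := proj_eq_proj_iff.1 hy.symm
    calc dist (s : AddCircle ℓ) t = dist (f (g (γ s))) (f (h (γ t))) := by
          rw [hfΓ g hg, hfΓ h hh, hfγ, hfγ]
      _ ≤ dist (g (γ s)) (h (γ t)) := by simpa using hf.dist_le_mul (g (γ s)) (h (γ t))

theorem isDisjointUnionOfCircles_of_isometry [T2Space (OrbitSpace Γ)] {n : ℕ} {ℓ : ℝ} (hℓ : 0 < ℓ)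
    {γ : Fin n → ℝ → M} {f : M → AddCircle ℓ} (hf : LipschitzWith 1 f)
    (hfΓ : ∀ g ∈ Γ, ∀ x, f (g x) = f x) (hγ : ∀ i, Isometry (γ i)) (hfγ : ∀ i t, f (γ i t) = t)
    (hper : ∀ i, Function.Periodic (fun t => proj Γ (γ i t)) ℓ)
    (hdisj : ∀ i j s t, proj Γ (γ i s) = proj Γ (γ j t) → i = j) :
    IsDisjointUnionOfCircles Γ {p | ∃ i t, proj Γ (γ i t) = p} n ℓ := by
  have : Fact (0 < ℓ) := ⟨hℓ⟩
  let F : Fin n × AddCircle ℓ → OrbitSpace Γ := fun q => (hper q.1).lift q.2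
  have hF : Continuous F := continuous_prod_of_discrete_left.2 fun i =>
    continuous_coinduced_dom.2 (isOpenQuotientMap_proj.continuous.comp (hγ i).continuous)
  have hinj : Function.Injective F := by
    rintro ⟨i, ⟨s⟩⟩ ⟨j, ⟨t⟩⟩ hst
    obtain rfl := hdisj i j s t hst
    obtain ⟨g, hg, hgs⟩ := proj_eq_proj_iff.1 hst
    exact congrArg (Prod.mk i) (((hfγ i s).symm.trans (hfΓ g hg _).symm).trans
      ((congrArg f hgs).trans (hfγ i t)))
  have hrange : Set.range F = {p | ∃ i t, proj Γ (γ i t) = p} := by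
    ext p
    constructor
    · rintro ⟨⟨i, ⟨t⟩⟩, rfl⟩
      exact ⟨i, t, rfl⟩
    · rintro ⟨i, t, rfl⟩
      exact ⟨(i, t), rfl⟩
  refine ⟨(hF.isClosedEmbedding hinj).toHomeomorph.trans (Homeomorph.setCongr hrange), fun i _ =>
    ⟨Set.univ, Filter.univ_mem, ?_⟩⟩
  rintro ⟨t⟩ - ⟨t'⟩ -
  exact orbitDist_proj_eq_dist hf hfΓ (hγ i) (hfγ i) (hper i) t t'

end OrbitSpace

theorem exists_pos_forall_abs_add_int_lt (a : ℝ) :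
    ∃ ε > 0, ∀ m : ℤ, |a + m| < ε → a + m = 0 := by
  have hclosed : IsClosed ((↑) '' {m : ℤ | (m : ℝ) ≠ -a} : Set ℝ) :=
    Int.isClosedEmbedding_coe_real.isClosedMap _ (isClosed_discrete _)
  obtain ⟨ε, hε, hball⟩ := Metric.isOpen_iff.1 hclosed.isOpen_compl (-a) fun ⟨_, hm, h⟩ => hm h
  refine ⟨ε, hε, fun m hm => ?_⟩
  by_contra hne
  refine hball (a := m) ?_ ⟨m, fun h => hne (by rw [h, add_neg_cancel]), rfl⟩
  rwa [Metric.mem_ball, Real.dist_eq, sub_neg_eq_add, add_comm]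

theorem IsGlideGroup.hasClosedDiscreteOrbits (hΓ : IsGlideGroup Γ c) :
    HasClosedDiscreteOrbits Γ := by
  intro x y
  choose ε hε hm using fun (j : Fin 4) (i : Fin 3) =>
    exists_pos_forall_abs_add_int_lt (((sgn j i : ℤ) : ℝ) * x i - y i)
  obtain ⟨δ, hδ, hδε⟩ := Pi.exists_forall_pos_add_lt fun p : Fin 4 × Fin 3 => hε p.1 p.2
  refine ⟨δ, hδ, fun g hg hd => PiLp.ext fun i => sub_eq_zero.1 ?_⟩
  obtain ⟨j, m, rfl⟩ := (hΓ.mem_iff g).1 hg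
  have hcoord : ((sgn j i : ℤ) : ℝ) * x i - y i + (2 * m i + c j i : ℤ) =
      (diag j (fun i => 2 * m i + c j i) x - y) i := sub_add_eq_add_sub _ _ _
  rw [dist_eq_norm] at hd
  have hlt := ((PiLp.norm_apply_le _ i).trans_lt hd).trans (by simpa using hδε (j, i))
  rw [← hcoord] at hlt
  exact hcoord.symm.trans (hm j i _ hlt)

theorem IsGlideGroup.apply_mem_verticalLines (hΓ : IsGlideGroup Γ c) {g : E 3 ≃ᵢ E 3} (hg : g ∈ Γ)
    {x : E 3} (hx : x ∈ verticalLines) : g x ∈ verticalLines := by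
  obtain ⟨j, m, rfl⟩ := (hΓ.mem_iff g).1 hg
  obtain ⟨⟨a, ha⟩, b, hb⟩ := hx
  refine ⟨⟨sgn j 0 * a + (2 * m 0 + c j 0), ?_⟩, ⟨sgn j 1 * b + (2 * m 1 + c j 1), ?_⟩⟩ <;>
    simp [diag_apply, ha, hb]

theorem IsGlideGroup.proj_mem_singularSet_iff (hΓ : IsGlideGroup Γ c) {x : E 3} :
    proj Γ x ∈ singularSet Γ ↔ x ∈ verticalLines := by
  constructor
  · rintro ⟨y, hy, hiso⟩
    obtain ⟨g, hg, rfl⟩ := proj_eq_proj_iff.1 hy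
    exact hΓ.apply_mem_verticalLines hg (hΓ.isotropy_ne_bot_iff.1 hiso)
  · exact fun hx => ⟨x, rfl, hΓ.isotropy_ne_bot_iff.2 hx⟩

theorem halfTurn_add_single (x : E 3) (s : ℝ) :
    halfTurn x (x + EuclideanSpace.single 0 s) = x + EuclideanSpace.single 0 (-s) := by
  ext i
  fin_cases i <;> simp [halfTurn_apply, sgn]
  ring

theorem not_locallyInjectiveAt_of_halfTurn_mem {x : E 3} (h : halfTurn x ∈ Γ) :
    ¬ LocallyInjectiveAt Γ x := by
  rintro ⟨U, hU, hinj⟩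
  obtain ⟨δ, hδ, hball⟩ := Metric.mem_nhds_iff.1 hU
  have hmem (s : ℝ) (hs : |s| < δ) : x + EuclideanSpace.single 0 s ∈ U := hball (by
    rwa [Metric.mem_ball, dist_eq_norm, add_sub_cancel_left, PiLp.norm_single])
  have hlt : |δ / 2| < δ := by rw [abs_of_pos (half_pos hδ)]; exact half_lt_self hδ
  have heq := hinj (hmem _ hlt) (hmem (-(δ / 2)) (by rwa [abs_neg]))
    (proj_eq_proj_iff.2 ⟨_, h, halfTurn_add_single x _⟩)
  have h0 : δ / 2 = -(δ / 2) := by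
    simpa using congrArg (fun y : E 3 => y 0) heq
  linarith

theorem IsGlideGroup.locallyInjectiveAt_iff (hΓ : IsGlideGroup Γ c) {x : E 3} :
    LocallyInjectiveAt Γ x ↔ x ∉ verticalLines :=
  ⟨fun h hx => not_locallyInjectiveAt_of_halfTurn_mem (hΓ.halfTurn_mem hx) h, fun hx =>
    hΓ.hasClosedDiscreteOrbits.locallyInjectiveAt (not_not.1 (mt hΓ.isotropy_ne_bot_iff.1 hx))⟩

theorem IsGlideGroup.nonempty_homeomorph_singularSet {Γ' : Subgroup (E 3 ≃ᵢ E 3)}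
    {c' : Fin 4 → Fin 3 → ℤ} (hΓ : IsGlideGroup Γ c) (hΓ' : IsGlideGroup Γ' c')
    (h : OrbifoldIsometric Γ Γ') : Nonempty (singularSet Γ ≃ₜ singularSet Γ') := by
  obtain ⟨f, hf⟩ := h
  refine ⟨f.subtype fun p => ?_⟩
  obtain ⟨x, rfl⟩ := isOpenQuotientMap_proj.surjective p
  obtain ⟨φ, hx, -, hφ⟩ := hf x
  rw [hφ x hx, hΓ.proj_mem_singularSet_iff, hΓ'.proj_mem_singularSet_iff, ← not_iff_not,
    ← hΓ.locallyInjectiveAt_iff, ← hΓ'.locallyInjectiveAt_iff]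
  exact locallyInjectiveAt_iff_of_lift hx hφ

/-- The point at height `t` on the vertical line through `(a, b)`. -/
noncomputable def linePoint (a : ℤ × ℤ) (t : ℝ) : E 3 := !₂[(a.1 : ℝ), (a.2 : ℝ), t]

theorem isometry_linePoint (a : ℤ × ℤ) : Isometry (linePoint a) := by
  refine Isometry.of_dist_eq fun s t => ?_
  simp [EuclideanSpace.dist_eq, linePoint, Fin.sum_univ_three, Real.sqrt_sq_eq_abs, Real.dist_eq]

theorem IsGlideGroup.singularSet_eq (hΓ : IsGlideGroup Γ c) :
    singularSet Γ = {p | ∃ a t, proj Γ (linePoint a t) = p} := by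
  ext p
  constructor
  · rintro ⟨x, rfl, hx⟩
    obtain ⟨⟨a, ha⟩, b, hb⟩ := hΓ.isotropy_ne_bot_iff.1 hx
    refine ⟨(a, b), x 2, congrArg (proj Γ) (PiLp.ext fun i => ?_)⟩
    fin_cases i <;> simp [linePoint, ha, hb]
  · rintro ⟨a, t, rfl⟩
    exact hΓ.proj_mem_singularSet_iff.2 ⟨⟨a.1, rfl⟩, ⟨a.2, rfl⟩⟩

theorem even_add_units_mul_add (ε : ℤˣ) (a b c : ℤ) : Even (b - ε * a - c) ↔ Even (a + b + c) := by
  rcases Int.units_eq_one_or ε with rfl | rfl <;> simp [parity_simps] <;> tauto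

theorem IsGlideGroup.proj_linePoint_eq_iff (hΓ : IsGlideGroup Γ c) {a b : ℤ × ℤ} {s t : ℝ} :
    proj Γ (linePoint a s) = proj Γ (linePoint b t) ↔
      ∃ j, Even (a.1 + b.1 + c j 0) ∧ Even (a.2 + b.2 + c j 1) ∧
        ∃ m : ℤ, t = s + (2 * m + c j 2 : ℤ) := by
  rw [proj_eq_proj_iff]
  constructor
  · rintro ⟨g, hg, hgs⟩
    obtain ⟨j, m, rfl⟩ := (hΓ.mem_iff g).1 hg
    have h (i : Fin 3) := congrArg (fun y : E 3 => y i) hgs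
    have h0 : ((sgn j 0 : ℤ) : ℝ) * a.1 + (2 * m 0 + c j 0 : ℤ) = b.1 := h 0
    have h1 : ((sgn j 1 : ℤ) : ℝ) * a.2 + (2 * m 1 + c j 1 : ℤ) = b.2 := h 1
    norm_cast at h0 h1
    refine ⟨j, ?_, ?_, m 2, ?_⟩
    · exact (even_add_units_mul_add (sgn j 0) _ _ _).1 ⟨m 0, by linear_combination -h0⟩
    · exact (even_add_units_mul_add (sgn j 1) _ _ _).1 ⟨m 1, by linear_combination -h1⟩
    · simpa [diag_apply, linePoint, sgn_apply_two] using (h 2).symm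
  · rintro ⟨j, h0, h1, m, rfl⟩
    obtain ⟨k, hk⟩ := (even_add_units_mul_add (sgn j 0) _ _ _).2 h0
    obtain ⟨l, hl⟩ := (even_add_units_mul_add (sgn j 1) _ _ _).2 h1
    refine ⟨_, (hΓ.mem_iff _).2 ⟨j, ![k, l, m], rfl⟩, PiLp.ext fun i => ?_⟩
    have hk' : ((sgn j 0 : ℤ) : ℝ) * a.1 + (2 * k + c j 0) = b.1 := by
      exact_mod_cast (by linear_combination -hk)
    have hl' : ((sgn j 1 : ℤ) : ℝ) * a.2 + (2 * l + c j 1) = b.2 := by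
      exact_mod_cast (by linear_combination -hl)
    fin_cases i <;> simp [diag_apply, linePoint, sgn_apply_two, hk', hl']

theorem proj_Gam₁_linePoint_eq_iff {a b : ℤ × ℤ} {s t : ℝ} :
    proj Gam₁ (linePoint a s) = proj Gam₁ (linePoint b t) ↔
      Even (a.1 + b.1 + (a.2 + b.2)) ∧ ∃ m : ℤ, t = s + 2 * m := by
  have h2 (j : Fin 4) : off₁ j 2 = 0 := (off₁_properties j).2.2
  have hex : (∃ j, Even (a.1 + b.1 + off₁ j 0) ∧ Even (a.2 + b.2 + off₁ j 1)) ↔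
      Even (a.1 + b.1 + (a.2 + b.2)) := by
    simp [Fin.exists_fin_succ, off₁, Int.even_add, -Int.not_even_iff_odd]
    tauto
  rw [isGlideGroup_Gam₁.proj_linePoint_eq_iff, ← hex]
  simp [h2, ← and_assoc]

theorem proj_Gam₂_linePoint_eq_iff {a b : ℤ × ℤ} {s t : ℝ} :
    proj Gam₂ (linePoint a s) = proj Gam₂ (linePoint b t) ↔
      Even (a.1 + b.1) ∧ Even (a.2 + b.2) ∧ ∃ m : ℤ, t = s + m := by
  have h01 (j : Fin 4) : off₂ j 0 = 0 ∧ off₂ j 1 = 0 := by revert j; decide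
  have hex (m : ℤ) : ∃ j l, m = 2 * l + off₂ j 2 := by
    rcases Int.even_or_odd' m with ⟨l, h | h⟩
    · exact ⟨0, l, h.trans (add_zero _).symm⟩
    · exact ⟨1, l, h⟩
  rw [isGlideGroup_Gam₂.proj_linePoint_eq_iff]
  simp only [h01, add_zero]
  constructor
  · rintro ⟨j, ha, hb, m, ht⟩
    exact ⟨ha, hb, _, ht⟩
  · rintro ⟨ha, hb, m, rfl⟩
    obtain ⟨j, l, rfl⟩ := hex m
    exact ⟨j, ha, hb, l, rfl⟩

theorem lipschitzWith_coe_apply (ℓ : ℝ) {n : ℕ} (i : Fin n) :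
    LipschitzWith 1 fun x : E n => (x i : AddCircle ℓ) := by
  refine LipschitzWith.of_dist_le_mul fun x y => ?_
  rw [NNReal.coe_one, one_mul, dist_eq_norm, ← AddCircle.coe_sub, dist_eq_norm]
  exact (QuotientAddGroup.norm_mk_le_norm).trans (PiLp.norm_apply_le (x - y) i)

theorem IsGlideGroup.isDisjointUnionOfCircles (hΓ : IsGlideGroup Γ c) {n : ℕ} {ℓ : ℝ} (hℓ : 0 < ℓ)
    {a : Fin n → ℤ × ℤ} (hshift : ∀ j (m : ℤ), ∃ k : ℤ, ((2 * m + c j 2 : ℤ) : ℝ) = k * ℓ)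
    (hper : ∀ i t, proj Γ (linePoint (a i) (t + ℓ)) = proj Γ (linePoint (a i) t))
    (hdisj : ∀ i j s t, proj Γ (linePoint (a i) s) = proj Γ (linePoint (a j) t) → i = j)
    (hcover : ∀ b, ∃ i, ∀ t, proj Γ (linePoint (a i) t) = proj Γ (linePoint b t)) :
    IsDisjointUnionOfCircles Γ (singularSet Γ) n ℓ := by
  have : T2Space (OrbitSpace Γ) := hΓ.hasClosedDiscreteOrbits.t2Space_orbitSpace
  have hS : singularSet Γ = {p | ∃ i t, proj Γ (linePoint (a i) t) = p} := by
    rw [hΓ.singularSet_eq]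
    ext p
    constructor
    · rintro ⟨b, t, rfl⟩
      obtain ⟨i, hi⟩ := hcover b
      exact ⟨i, t, hi t⟩
    · exact fun ⟨i, t, h⟩ => ⟨a i, t, h⟩
  have hinv : ∀ g ∈ Γ, ∀ x, ((g x 2 : ℝ) : AddCircle ℓ) = x 2 := by
    intro g hg x
    obtain ⟨j, m, rfl⟩ := (hΓ.mem_iff g).1 hg
    obtain ⟨k, hk⟩ := hshift j (m 2)
    rw [diag_apply, sgn_apply_two, Units.val_one, Int.cast_one, one_mul, AddCircle.coe_add, hk,
      (AddCircle.coe_eq_zero_iff ℓ).2 ⟨k, zsmul_eq_mul _ _⟩, add_zero]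
  rw [hS]
  exact isDisjointUnionOfCircles_of_isometry hℓ (lipschitzWith_coe_apply ℓ 2) hinv
    (fun i => isometry_linePoint (a i)) (fun _ _ => rfl) hper hdisj

theorem card_connectedComponents_of_homeomorph_prod {ι X S : Type*} [TopologicalSpace ι]
    [TotallyDisconnectedSpace ι] [TopologicalSpace X] [ConnectedSpace X] [TopologicalSpace S]
    (e : (ι × X) ≃ₜ S) : Nat.card (ConnectedComponents S) = Nat.card ι := by
  have hc : Continuous fun s => (e.symm s).1 := continuous_fst.comp e.symm.continuous
  refine Nat.card_eq_of_bijective hc.connectedComponentsLift ⟨fun a b hab => ?_, fun i => ?_⟩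
  · obtain ⟨s, rfl⟩ := ConnectedComponents.surjective_coe a
    obtain ⟨t, rfl⟩ := ConnectedComponents.surjective_coe b
    rw [hc.connectedComponentsLift_apply_coe, hc.connectedComponentsLift_apply_coe] at hab
    have hpre : IsPreconnected (e '' ({(e.symm t).1} ×ˢ Set.univ)) :=
      (isPreconnected_singleton.prod isPreconnected_univ).image _ e.continuous.continuousOn
    exact ConnectedComponents.coe_eq_coe'.2 (hpre.subset_connectedComponent
      ⟨e.symm t, ⟨rfl, trivial⟩, e.apply_symm_apply t⟩
      ⟨e.symm s, ⟨hab, trivial⟩, e.apply_symm_apply s⟩)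
  · obtain ⟨x⟩ : Nonempty X := inferInstance
    refine ⟨ConnectedComponents.mk (e (i, x)), ?_⟩
    rw [hc.connectedComponentsLift_apply_coe, e.symm_apply_apply]

theorem IsDisjointUnionOfCircles.card_connectedComponents {M : Type*} [PseudoMetricSpace M]
    {Γ : Subgroup (M ≃ᵢ M)} {S : Set (OrbitSpace Γ)} {n : ℕ} {ℓ : ℝ}
    (h : IsDisjointUnionOfCircles Γ S n ℓ) : Nat.card (ConnectedComponents S) = n := by
  obtain ⟨e, -⟩ := h
  rw [card_connectedComponents_of_homeomorph_prod e, Nat.card_fin]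

theorem isDisjointUnionOfCircles_Gam₁ : IsDisjointUnionOfCircles Gam₁ (singularSet Gam₁) 2 2 := by
  refine isGlideGroup_Gam₁.isDisjointUnionOfCircles two_pos (a := ![(0, 0), (0, 1)]) ?_ ?_ ?_ ?_
  · exact fun j m => ⟨m, by simp [(off₁_properties j).2.2, mul_comm]⟩
  · exact fun i t => proj_Gam₁_linePoint_eq_iff.2 ⟨⟨_, add_add_add_comm _ _ _ _⟩, -1, by simp⟩
  · intro i j s t h
    have heven := (proj_Gam₁_linePoint_eq_iff.1 h).1
    clear h
    revert i j
    decide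
  · intro b
    simp only [proj_Gam₁_linePoint_eq_iff]
    rcases Int.even_or_odd (b.1 + b.2) with h | h
    · exact ⟨0, fun t => ⟨by simpa using h, 0, by simp⟩⟩
    · exact ⟨1, fun t => ⟨by simpa [add_left_comm] using h.one_add, 0, by simp⟩⟩

theorem isDisjointUnionOfCircles_Gam₂ : IsDisjointUnionOfCircles Gam₂ (singularSet Gam₂) 4 1 := by
  refine isGlideGroup_Gam₂.isDisjointUnionOfCircles one_pos
    (a := ![(0, 0), (0, 1), (1, 0), (1, 1)]) ?_ ?_ ?_ ?_
  · exact fun _ _ => ⟨_, (mul_one _).symm⟩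
  · exact fun i t => proj_Gam₂_linePoint_eq_iff.2 ⟨⟨_, rfl⟩, ⟨_, rfl⟩, -1, by simp⟩
  · intro i j s t h
    obtain ⟨h0, h1, -⟩ := proj_Gam₂_linePoint_eq_iff.1 h
    clear h
    revert i j
    decide
  · intro b
    simp only [proj_Gam₂_linePoint_eq_iff]
    rcases Int.even_or_odd b.1 with h | h <;> rcases Int.even_or_odd b.2 with h' | h'
    · exact ⟨0, fun t => ⟨by simpa using h, by simpa using h', 0, by simp⟩⟩
    · exact ⟨1, fun t => ⟨by simpa using h, h'.one_add, 0, by simp⟩⟩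
    · exact ⟨2, fun t => ⟨h.one_add, by simpa using h', 0, by simp⟩⟩
    · exact ⟨3, fun t => ⟨h.one_add, h'.one_add, 0, by simp⟩⟩

theorem card_components_Gam₁ : Nat.card (ConnectedComponents (singularSet Gam₁)) = 2 :=
  isDisjointUnionOfCircles_Gam₁.card_connectedComponents

theorem card_components_Gam₂ : Nat.card (ConnectedComponents (singularSet Gam₂)) = 4 :=
  isDisjointUnionOfCircles_Gam₂.card_connectedComponents

theorem not_orbifoldIsometric_Gam₁_Gam₂ : ¬ OrbifoldIsometric Gam₁ Gam₂ := by
  intro h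
  obtain ⟨f⟩ := isGlideGroup_Gam₁.nonempty_homeomorph_singularSet isGlideGroup_Gam₂ h
  obtain ⟨e, -⟩ := isDisjointUnionOfCircles_Gam₁
  have hcard := card_connectedComponents_of_homeomorph_prod (e.trans f)
  rw [card_components_Gam₂, Nat.card_fin] at hcard
  omega

/-! ### Eigenfunctions of the Laplace operator on the torus -/

section FourierCoefficients

open MeasureTheory

variable {ι : Type*}

/-- Functions on `ℝ^ι` invariant under translation by `ℤ^ι`, that is, functions on the unit
torus. -/
def IntPeriodic (u : (ι → ℝ) → ℂ) : Prop :=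
  ∀ (x : ι → ℝ) (m : ι → ℤ), u (x + fun i => (m i : ℝ)) = u x

theorem IntPeriodic.apply_add_single [DecidableEq ι] {u : (ι → ℝ) → ℂ} (hu : IntPeriodic u)
    (x : ι → ℝ) (i : ι) : u (x + Pi.single i 1) = u x := by
  have hcast : (fun j => ((Pi.single i 1 : ι → ℤ) j : ℝ)) = Pi.single i 1 := by
    ext j
    obtain rfl | hj := eq_or_ne j i
    · simp
    · simp [hj]
  exact hcast ▸ hu x (Pi.single i 1)

theorem IntPeriodic.mul {u v : (ι → ℝ) → ℂ} (hu : IntPeriodic u) (hv : IntPeriodic v) :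
    IntPeriodic fun x => u x * v x := fun x m => congrArg₂ (· * ·) (hu x m) (hv x m)

theorem isQuotientMap_coe_unitAddTorus :
    Topology.IsQuotientMap fun (x : ι → ℝ) (i : ι) => (x i : UnitAddCircle) :=
  (IsOpenQuotientMap.piMap fun _ : ι => (QuotientAddGroup.isOpenQuotientMap_mk :
    IsOpenQuotientMap (QuotientAddGroup.mk : ℝ → UnitAddCircle))).isQuotientMap

theorem IntPeriodic.apply_eq_of_coe_eq {u : (ι → ℝ) → ℂ} (hu : IntPeriodic u) {x y : ι → ℝ}
    (h : ∀ i, (x i : UnitAddCircle) = y i) : u x = u y := by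
  have hdiff (i : ι) : ∃ m : ℤ, x i = y i + m := by
    obtain ⟨m, hm⟩ := (AddCircle.coe_eq_zero_iff 1).1 (sub_eq_zero.2 (h i))
    exact ⟨m, sub_eq_iff_eq_add'.1 (hm.symm.trans (zsmul_one m))⟩
  choose m hm using hdiff
  rw [show x = y + fun i => (m i : ℝ) from funext hm, hu]

theorem IntPeriodic.fderiv_apply [Finite ι] {u : (ι → ℝ) → ℂ} (hu : IntPeriodic u) (v : ι → ℝ) :
    IntPeriodic fun x => fderiv ℝ u x v := fun x m => by
  have := Fintype.ofFinite ι
  change fderiv ℝ u (x + fun i => (m i : ℝ)) v = fderiv ℝ u x v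
  rw [← fderiv_comp_add_right]
  simp only [hu _ m]

variable [Fintype ι]

/-- The linear form `x ↦ -2πi⟨k, x⟩`, whose exponential is the character of the unit torus against
which the `k`-th Fourier coefficient is computed. -/
noncomputable def phase (k : ι → ℤ) : (ι → ℝ) →L[ℝ] ℂ :=
  ∑ j, (ContinuousLinearMap.proj j).smulRight (-(2 * Real.pi * Complex.I * k j) : ℂ)

theorem phase_apply (k : ι → ℤ) (x : ι → ℝ) :
    phase k x = ∑ j, x j * -(2 * Real.pi * Complex.I * k j) := by
  simp [phase]

theorem phase_single [DecidableEq ι] (k : ι → ℤ) (i : ι) :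
    phase k (Pi.single i 1) = -(2 * Real.pi * Complex.I * k i) := by
  rw [phase_apply, Finset.sum_eq_single i (fun j _ hj => by simp [hj]) (by simp)]
  simp

theorem exp_phase_eq_mFourier (k : ι → ℤ) (x : ι → ℝ) :
    Complex.exp (phase k x) = UnitAddTorus.mFourier (-k) fun i => (x i : UnitAddCircle) := by
  rw [phase_apply, Complex.exp_sum]
  refine Finset.prod_congr rfl fun i _ => ?_
  rw [fourier_coe_apply, Pi.neg_apply]
  congr 1
  push_cast
  ring

theorem intPeriodic_exp_phase (k : ι → ℤ) : IntPeriodic fun x => Complex.exp (phase k x) :=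
  fun x m => by
    simp only [exp_phase_eq_mFourier, Pi.add_apply]
    congr 1
    funext i
    rw [AddCircle.coe_add, add_eq_left, AddCircle.coe_eq_zero_iff]
    exact ⟨m i, by simp⟩

theorem contDiff_exp_phase (k : ι → ℤ) : ContDiff ℝ ∞ fun x => Complex.exp (phase k x) :=
  Complex.contDiff_exp.comp (phase k).contDiff

/-- The `k`-th Fourier coefficient of a function on the unit torus `ℝ^ι / ℤ^ι`. -/
noncomputable def torusCoeff (k : ι → ℤ) (u : (ι → ℝ) → ℂ) : ℂ :=
  ∫ x in Set.Icc (0 : ι → ℝ) 1, Complex.exp (phase k x) * u x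

theorem integrableOn_exp_phase_mul {u : (ι → ℝ) → ℂ} (hu : Continuous u) (k : ι → ℤ) :
    IntegrableOn (fun x => Complex.exp (phase k x) * u x) (Set.Icc (0 : ι → ℝ) 1) :=
  ((contDiff_exp_phase k).continuous.mul hu).continuousOn.integrableOn_compact isCompact_Icc

theorem torusCoeff_add {u v : (ι → ℝ) → ℂ} (hu : Continuous u) (hv : Continuous v) (k : ι → ℤ) :
    torusCoeff k (fun x => u x + v x) = torusCoeff k u + torusCoeff k v := by
  simp only [torusCoeff, mul_add]
  exact integral_add (integrableOn_exp_phase_mul hu k) (integrableOn_exp_phase_mul hv k)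

theorem torusCoeff_sum {κ : Type*} {u : κ → (ι → ℝ) → ℂ} (s : Finset κ)
    (hu : ∀ j, Continuous (u j)) (k : ι → ℤ) :
    torusCoeff k (fun x => ∑ j ∈ s, u j x) = ∑ j ∈ s, torusCoeff k (u j) := by
  simp only [torusCoeff, Finset.mul_sum]
  exact integral_finsetSum s fun j _ => integrableOn_exp_phase_mul (hu j) k

theorem torusCoeff_const_mul (k : ι → ℤ) (a : ℂ) (u : (ι → ℝ) → ℂ) :
    torusCoeff k (fun x => a * u x) = a * torusCoeff k u := by
  simp only [torusCoeff, mul_left_comm _ a]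
  exact integral_const_mul a _

theorem mFourierCoeff_eq_torusCoeff {u : (ι → ℝ) → ℂ} {F : UnitAddTorus ι → ℂ}
    (hF : ∀ x : ι → ℝ, F (fun i => (x i : UnitAddCircle)) = u x) (k : ι → ℤ) :
    UnitAddTorus.mFourierCoeff F k = torusCoeff k u := by
  have hcube : {x : ι → ℝ | ∀ i, x i ∈ Set.Ioc ((0 : ι → ℝ) i) ((0 : ι → ℝ) i + 1)} =
      Set.univ.pi fun i => Set.Ioc ((0 : ι → ℝ) i) ((1 : ι → ℝ) i) := by
    ext x
    simp [Set.mem_pi]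
  rw [UnitAddTorus.mFourierCoeff_eq_integral F k 0, hcube, volume_pi,
    setIntegral_congr_set Measure.univ_pi_Ioc_ae_eq_Icc, ← volume_pi]
  simp only [hF, smul_eq_mul, ← exp_phase_eq_mFourier]
  rfl

theorem IntPeriodic.eq_zero_of_torusCoeff_eq_zero {u : (ι → ℝ) → ℂ} (hu : IntPeriodic u)
    (hcont : Continuous u) (h : ∀ k, torusCoeff k u = 0) : u = 0 := by
  let q : C(ι → ℝ, UnitAddTorus ι) := ⟨fun x i => (x i : UnitAddCircle), by fun_prop⟩
  have hq : Topology.IsQuotientMap q := isQuotientMap_coe_unitAddTorus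
  have hfac : Function.FactorsThrough (⟨u, hcont⟩ : C(ι → ℝ, ℂ)) q :=
    fun x y hxy => hu.apply_eq_of_coe_eq (congrFun hxy)
  let F : C(UnitAddTorus ι, ℂ) := hq.lift ⟨u, hcont⟩ hfac
  have hF (x : ι → ℝ) : F (q x) = u x := DFunLike.congr_fun (hq.lift_comp _ hfac) x
  have hcoeff : UnitAddTorus.mFourierCoeff F = 0 :=
    funext fun k => (mFourierCoeff_eq_torusCoeff hF k).trans (h k)
  funext x
  have hseries := UnitAddTorus.hasSum_mFourier_series_apply_of_summable
    (f := F) (hcoeff ▸ summable_zero) (q x)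
  simp only [hcoeff, hF, Pi.zero_apply, zero_smul] at hseries
  exact hseries.unique hasSum_zero

theorem finite_setOf_sum_sq_eq (ν : ℝ) :
    {k : ι → ℤ | 4 * Real.pi ^ 2 * ∑ i, (k i : ℝ) ^ 2 = ν}.Finite := by
  have hpi : 1 ≤ 4 * Real.pi ^ 2 := by nlinarith [Real.pi_gt_three]
  refine (isCompact_closedBall (0 : ι → ℤ) ν).finite_of_discrete.subset fun k hk => ?_
  have hsum : ∑ i, (k i : ℝ) ^ 2 ≤ ν :=
    (le_mul_of_one_le_left (Finset.sum_nonneg fun i _ => sq_nonneg _) hpi).trans_eq hk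
  have hν : 0 ≤ ν := (Finset.sum_nonneg fun i _ => sq_nonneg _).trans hsum
  rw [mem_closedBall_zero_iff, pi_norm_le_iff_of_nonneg hν]
  intro i
  calc ‖k i‖ = ((|k i| : ℤ) : ℝ) := by rw [Int.norm_eq_abs, Int.cast_abs]
    _ ≤ ((k i ^ 2 : ℤ) : ℝ) := by exact_mod_cast (Int.le_self_sq |k i|).trans_eq (sq_abs _)
    _ ≤ ∑ i, (k i : ℝ) ^ 2 := by
      push_cast
      exact Finset.single_le_sum (f := fun i => (k i : ℝ) ^ 2) (fun i _ => sq_nonneg _)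
        (Finset.mem_univ i)
    _ ≤ ν := hsum

end FourierCoefficients

section FourierDerivatives

open MeasureTheory

variable {n : ℕ}

theorem integral_fderiv_single_eq_zero {u : (Fin (n + 1) → ℝ) → ℂ} (hu : ContDiff ℝ 1 u)
    (hper : IntPeriodic u) (i : Fin (n + 1)) :
    ∫ x in Set.Icc (0 : Fin (n + 1) → ℝ) 1, fderiv ℝ u x (Pi.single i 1) = 0 := by
  have hsum (x : Fin (n + 1) → ℝ) : fderiv ℝ u x (Pi.single i 1) =
      ∑ j, (if j = i then fderiv ℝ u x else 0) (Pi.single j 1) := by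
    rw [Finset.sum_eq_single i (fun j _ hj => by simp [hj]) (by simp), if_pos rfl]
  have hintegrable : IntegrableOn (fun x => fderiv ℝ u x (Pi.single i 1))
      (Set.Icc (0 : Fin (n + 1) → ℝ) 1) :=
    ((hu.continuous_fderiv one_ne_zero).clm_apply
      continuous_const).continuousOn.integrableOn_compact isCompact_Icc
  simp only [hsum] at hintegrable ⊢
  rw [integral_divergence_of_hasFDerivAt_off_countable' 0 1 zero_le_one
    (fun j => if j = i then u else 0) _ ∅ Set.countable_empty _ _ hintegrable]
  · refine Finset.sum_eq_zero fun j _ => sub_eq_zero.2 (congrArg _ (funext fun y => ?_))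
    obtain rfl | hj := eq_or_ne j i
    · rw [if_pos rfl, ← hper.apply_add_single (j.insertNth ((0 : Fin (n + 1) → ℝ) j) y) j]
      congr 1
      ext l
      obtain rfl | ⟨l, rfl⟩ := Fin.eq_self_or_eq_succAbove j l <;> simp
    · rw [if_neg hj, Pi.zero_apply, Pi.zero_apply]
  · intro j
    split_ifs
    exacts [hu.continuous.continuousOn, continuousOn_const]
  · intro x _ j
    split_ifs
    exacts [(hu.differentiable one_ne_zero x).hasFDerivAt, hasFDerivAt_const 0 x]

theorem torusCoeff_fderiv_single {u : (Fin (n + 1) → ℝ) → ℂ} (hu : ContDiff ℝ 1 u)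
    (hper : IntPeriodic u) (k : Fin (n + 1) → ℤ) (i : Fin (n + 1)) :
    torusCoeff k (fun x => fderiv ℝ u x (Pi.single i 1)) =
      2 * Real.pi * Complex.I * k i * torusCoeff k u := by
  have hwave : ContDiff ℝ 1 fun x => Complex.exp (phase k x) :=
    (contDiff_exp_phase k).of_le (by simp)
  have hderiv (x : Fin (n + 1) → ℝ) :
      fderiv ℝ (fun x => Complex.exp (phase k x) * u x) x (Pi.single i 1) =
        Complex.exp (phase k x) * fderiv ℝ u x (Pi.single i 1) -
          2 * Real.pi * Complex.I * k i * (Complex.exp (phase k x) * u x) := by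
    rw [fderiv_fun_mul (hwave.differentiable one_ne_zero x) (hu.differentiable one_ne_zero x),
      (phase k).hasFDerivAt.cexp.fderiv, add_apply, smul_apply, smul_apply, smul_apply,
      phase_single]
    simp only [smul_eq_mul]
    ring
  have hzero := integral_fderiv_single_eq_zero (hwave.mul hu) ((intPeriodic_exp_phase k).mul hper) i
  simp only [hderiv] at hzero
  rw [integral_sub (integrableOn_exp_phase_mul
      ((hu.continuous_fderiv one_ne_zero).clm_apply continuous_const) k)
    ((integrableOn_exp_phase_mul hu.continuous k).const_mul _), integral_const_mul] at hzero
  exact sub_eq_zero.1 hzero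

theorem torusCoeff_iteratedFDeriv_two_single {u : (Fin (n + 1) → ℝ) → ℂ} (hu : ContDiff ℝ 2 u)
    (hper : IntPeriodic u) (k : Fin (n + 1) → ℤ) (i : Fin (n + 1)) :
    torusCoeff k (fun x => iteratedFDeriv ℝ 2 u x fun _ => Pi.single i 1) =
      -(4 * Real.pi ^ 2 * k i ^ 2) * torusCoeff k u := by
  have hderiv : ContDiff ℝ 1 fun x => fderiv ℝ u x (Pi.single i 1) :=
    (hu.fderiv_right (by norm_num)).clm_apply contDiff_const
  have hsecond (x : Fin (n + 1) → ℝ) : (iteratedFDeriv ℝ 2 u x fun _ => Pi.single i 1) =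
      fderiv ℝ (fun y => fderiv ℝ u y (Pi.single i 1)) x (Pi.single i 1) := by
    rw [iteratedFDeriv_two_apply, fderiv_clm_apply
      ((hu.fderiv_right (by norm_num)).differentiable one_ne_zero x) (differentiableAt_const _)]
    simp
  simp only [hsecond]
  rw [torusCoeff_fderiv_single hderiv (hper.fderiv_apply _),
    torusCoeff_fderiv_single (hu.of_le (by norm_num)) hper]
  linear_combination 4 * Real.pi ^ 2 * (k i : ℂ) ^ 2 * torusCoeff k u * Complex.I_sq

theorem torusCoeff_eq_zero_of_laplace_eq {u : (Fin (n + 1) → ℝ) → ℂ} (hu : ContDiff ℝ 2 u)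
    (hper : IntPeriodic u) {ν : ℝ}
    (hlap : ∀ x, ∑ i, (iteratedFDeriv ℝ 2 u x fun _ => Pi.single i 1) = -ν * u x)
    {k : Fin (n + 1) → ℤ} (hk : 4 * Real.pi ^ 2 * ∑ i, (k i : ℝ) ^ 2 ≠ ν) : torusCoeff k u = 0 := by
  have hcoeff := torusCoeff_sum (u := fun i x => iteratedFDeriv ℝ 2 u x fun _ => Pi.single i 1)
    Finset.univ (fun i => ?_) k
  · simp only [hlap, torusCoeff_const_mul, torusCoeff_iteratedFDeriv_two_single hu hper,
      ← Finset.sum_mul] at hcoeff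
    have hfactor : ((4 * Real.pi ^ 2 * ∑ i, (k i : ℝ) ^ 2 - ν : ℝ) : ℂ) * torusCoeff k u = 0 := by
      push_cast
      rw [Finset.mul_sum]
      rw [Finset.sum_neg_distrib] at hcoeff
      linear_combination hcoeff
    exact (mul_eq_zero.1 hfactor).resolve_left (Complex.ofReal_ne_zero.2 (sub_ne_zero.2 hk))
  · have := hu.continuous_iteratedFDeriv le_rfl
    fun_prop

end FourierDerivatives

section TorusEigenfunctions

variable {n : ℕ}

theorem contDiff_two_of_mem_eigenspace {Γ : Subgroup (E n ≃ᵢ E n)} {μ : ℝ} {f : E n → ℝ}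
    (hf : f ∈ eigenspace Γ μ) : ContDiff ℝ 2 f :=
  contDiff_infty.1 hf.1 2

theorem apply_add_of_mem_eigenspace {Λ : AddSubgroup (E n)} {μ : ℝ} {f : E n → ℝ}
    (hf : f ∈ eigenspace (translGroup Λ) μ) {v : E n} (hv : v ∈ Λ) (x : E n) :
    f (x + v) = f x :=
  hf.2.1 _ ⟨v, hv, rfl⟩ x

/-- The parametrization `t ↦ 2t` of `ℝⁿ`, which carries `ℤⁿ` to `(2ℤ)ⁿ`. -/
noncomputable def doubling : (Fin n → ℝ) →L[ℝ] E n :=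
  (2 : ℝ) • ((EuclideanSpace.equiv (Fin n) ℝ).symm : (Fin n → ℝ) →L[ℝ] E n)

theorem doubling_single (i : Fin n) :
    doubling (Pi.single i 1) = (2 : ℝ) • EuclideanSpace.basisFun (Fin n) ℝ i := by
  ext j
  simp [doubling]

theorem surjective_doubling : Function.Surjective (doubling (n := n)) := fun x =>
  ⟨fun i => x i / 2, by ext i; exact mul_div_cancel₀ (x i) two_ne_zero⟩

theorem contDiff_comp_doubling {f : E n → ℝ} (hf : ContDiff ℝ 2 f) :
    ContDiff ℝ 2 fun t => (f (doubling t) : ℂ) :=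
  Complex.ofRealCLM.contDiff.comp (hf.comp doubling.contDiff)

theorem sum_iteratedFDeriv_comp_doubling {f : E n → ℝ} (hf : ContDiff ℝ 2 f) (t : Fin n → ℝ) :
    ∑ i, (iteratedFDeriv ℝ 2 (fun t => (f (doubling t) : ℂ)) t fun _ => Pi.single i 1) =
      4 * (Laplacian.laplacian f (doubling t) : ℂ) := by
  rw [InnerProductSpace.laplacian_eq_iteratedFDeriv_orthonormalBasis f
    (EuclideanSpace.basisFun (Fin n) ℝ), Complex.ofReal_sum, Finset.mul_sum]
  refine Finset.sum_congr rfl fun i _ => ?_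
  have hleft := Complex.ofRealCLM.iteratedFDeriv_comp_left
    (hf.comp doubling.contDiff).contDiffAt (x := t) le_rfl
  refine (DFunLike.congr_fun hleft _).trans ?_
  rw [ContinuousLinearMap.compContinuousMultilinearMap_coe, Function.comp_apply,
    doubling.iteratedFDeriv_comp_right hf t le_rfl,
    ContinuousMultilinearMap.compContinuousLinearMap_apply]
  simp only [doubling_single, iteratedFDeriv_two_apply, map_smul, smul_apply, smul_eq_mul,
    Matrix.cons_val_zero, Matrix.cons_val_one, Complex.ofRealCLM_apply]
  push_cast
  ring

theorem intPeriodic_comp_doubling {μ : ℝ} {f : E 3 → ℝ} (hf : f ∈ eigenspace (translGroup Lam) μ) :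
    IntPeriodic fun t => (f (doubling t) : ℂ) := fun t m => by
  change (f (doubling (t + fun i => (m i : ℝ))) : ℂ) = f (doubling t)
  rw [map_add, apply_add_of_mem_eigenspace hf fun i => ⟨m i, rfl⟩]

theorem torusCoeff_comp_doubling_eq_zero {μ : ℝ} {f : E 3 → ℝ}
    (hf : f ∈ eigenspace (translGroup Lam) μ) {k : Fin 3 → ℤ}
    (hk : 4 * Real.pi ^ 2 * ∑ i, (k i : ℝ) ^ 2 ≠ 4 * μ) :
    torusCoeff k (fun t => (f (doubling t) : ℂ)) = 0 := by
  have hf₂ := contDiff_two_of_mem_eigenspace hf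
  refine torusCoeff_eq_zero_of_laplace_eq (contDiff_comp_doubling hf₂)
    (intPeriodic_comp_doubling hf) (fun t => ?_) hk
  rw [sum_iteratedFDeriv_comp_doubling hf₂, ← neg_neg (Laplacian.laplacian f (doubling t)),
    hf.2.2 (doubling t)]
  push_cast
  ring

/-- The Fourier coefficients of an eigenfunction on the torus at the finitely many frequencies where
they can be nonzero. -/
noncomputable def eigenCoeffs (μ : ℝ) : eigenspace (translGroup Lam) μ →ₗ[ℝ]
    ({k : Fin 3 → ℤ | 4 * Real.pi ^ 2 * ∑ i, (k i : ℝ) ^ 2 = 4 * μ} → ℂ) where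
  toFun f k := torusCoeff k fun t => (f.1 (doubling t) : ℂ)
  map_add' f g := funext fun k => by
    have hf := (contDiff_comp_doubling (contDiff_two_of_mem_eigenspace f.2)).continuous
    have hg := (contDiff_comp_doubling (contDiff_two_of_mem_eigenspace g.2)).continuous
    rw [Pi.add_apply, ← torusCoeff_add hf hg]
    simp
  map_smul' a f := funext fun k => by
    rw [Pi.smul_apply, Complex.real_smul, RingHom.id_apply, ← torusCoeff_const_mul]
    simp

theorem injective_eigenCoeffs (μ : ℝ) : Function.Injective (eigenCoeffs μ) := by
  refine (injective_iff_map_eq_zero _).2 fun f hf => Subtype.ext ?_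
  have hzero := (intPeriodic_comp_doubling f.2).eq_zero_of_torusCoeff_eq_zero
    (contDiff_comp_doubling (contDiff_two_of_mem_eigenspace f.2)).continuous fun k => ?_
  · refine surjective_doubling.injective_comp_right (funext fun t => ?_)
    exact Complex.ofReal_eq_zero.1 (congrFun hzero t)
  · by_cases hk : 4 * Real.pi ^ 2 * ∑ i, (k i : ℝ) ^ 2 = 4 * μ
    · exact congrFun hf ⟨k, hk⟩
    · exact torusCoeff_comp_doubling_eq_zero f.2 hk

instance finiteDimensional_eigenspace_translGroup (μ : ℝ) :
    FiniteDimensional ℝ (eigenspace (translGroup Lam) μ) :=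
  have := (finite_setOf_sum_sq_eq (ι := Fin 3) (4 * μ)).to_subtype
  FiniteDimensional.of_injective _ (injective_eigenCoeffs μ)

end TorusEigenfunctions

/-! ### Sunada's theorem -/

section Isometries

variable {n : ℕ}

theorem apply_eq_linearPart_add (g : E n ≃ᵢ E n) (x : E n) : g x = linearPart g x + g 0 := by
  rw [← sub_eq_iff_eq_add, ← linearPart_sub, sub_zero]

theorem contDiff_isometryEquiv (g : E n ≃ᵢ E n) : ContDiff ℝ ∞ g := by
  rw [funext (apply_eq_linearPart_add g)]
  exact (linearPart g).contDiff.add contDiff_const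

theorem laplacian_comp_isometryEquiv {f : E n → ℝ} (hf : ContDiff ℝ 2 f) (g : E n ≃ᵢ E n)
    (x : E n) : Laplacian.laplacian (fun y => f (g y)) x = Laplacian.laplacian f (g x) := by
  let b := EuclideanSpace.basisFun (Fin n) ℝ
  have hshift : ContDiff ℝ 2 fun z => f (z + g 0) := hf.comp (contDiff_id.add contDiff_const)
  have hcomp : (fun y => f (g y)) = (fun z => f (z + g 0)) ∘ (linearPart g : E n →L[ℝ] E n) :=
    funext fun y => congrArg f (apply_eq_linearPart_add g y)
  rw [InnerProductSpace.laplacian_eq_iteratedFDeriv_orthonormalBasis _ b,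
    InnerProductSpace.laplacian_eq_iteratedFDeriv_orthonormalBasis f (b.map (linearPart g))]
  refine Finset.sum_congr rfl fun i _ => ?_
  rw [hcomp, ContinuousLinearMap.iteratedFDeriv_comp_right _ hshift x le_rfl,
    ContinuousMultilinearMap.compContinuousLinearMap_apply, apply_eq_linearPart_add g x]
  refine (DFunLike.congr_fun (iteratedFDeriv_comp_add_right 2 (g 0) (linearPart g x)) _).trans
    (congrArg _ (funext fun k => ?_))
  fin_cases k <;> exact (b.map_apply (linearPart g) i).symm

end Isometries

section AlmostConjugate

variable {G : Type*} [Group G] {H₁ H₂ : Subgroup G}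

theorem AlmostConjugate.exists_equiv (h : AlmostConjugate H₁ H₂) :
    ∃ e : H₁ ≃ H₂, ∀ k : H₁, IsConj (k : G) (e k) := by
  obtain ⟨_, _, hcard⟩ := h
  have hfiber (H : Subgroup G) (b : G) :
      Nat.card {k : H // ConjClasses.mk (k : G) = ConjClasses.mk b} =
        (conjugatesOf b ∩ (H : Set G)).ncard := by
    rw [← Nat.card_coe_set_eq]
    refine Nat.card_congr ⟨fun k => ⟨k.1, ?_, k.1.2⟩, fun k => ⟨⟨k.1, k.2.2⟩, ?_⟩,
      fun _ => rfl, fun _ => rfl⟩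
    · exact (ConjClasses.mk_eq_mk_iff_isConj.1 k.2).symm
    · exact ConjClasses.mk_eq_mk_iff_isConj.2 k.2.1.symm
  have hequiv (C : ConjClasses G) : Nonempty ({k : H₁ // ConjClasses.mk (k : G) = C} ≃
      {k : H₂ // ConjClasses.mk (k : G) = C}) := by
    obtain ⟨b, rfl⟩ := ConjClasses.mk_surjective C
    exact Finite.card_eq.1 ((hfiber H₁ b).trans ((hcard b).trans (hfiber H₂ b).symm))
  refine ⟨Equiv.ofFiberEquiv fun C => (hequiv C).some, fun k => ?_⟩
  exact ConjClasses.mk_eq_mk_iff_isConj.1 (Equiv.ofFiberEquiv_map (fun C => (hequiv C).some) k).symm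

theorem AlmostConjugate.finrank_invariants_eq {k V : Type*} [Field k] [CharZero k]
    [AddCommGroup V] [Module k V] [FiniteDimensional k V] (h : AlmostConjugate H₁ H₂)
    (ρ : Representation k G V) :
    Module.finrank k (Representation.invariants (ρ.comp H₁.subtype)) =
      Module.finrank k (Representation.invariants (ρ.comp H₂.subtype)) := by
  obtain ⟨e, he⟩ := h.exists_equiv
  obtain ⟨_, _, -⟩ := h
  have := Fintype.ofFinite H₁
  have := Fintype.ofFinite H₂
  have (H : Subgroup G) [Finite H] : Invertible (Nat.card H : k) :=
    invertibleOfNonzero (Nat.cast_ne_zero.2 Nat.card_pos.ne')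
  have hchar (a : H₁) :
      Representation.character (ρ.comp H₁.subtype) a =
        Representation.character (ρ.comp H₂.subtype) (e a) := by
    obtain ⟨g, hg⟩ := isConj_iff.1 (he a)
    change ρ.character a = ρ.character (e a)
    rw [← hg, ρ.char_conj]
  rw [← Nat.cast_inj (R := k), ← Representation.card_inv_mul_sum_char_eq_finrank,
    ← Representation.card_inv_mul_sum_char_eq_finrank, Nat.card_congr e,
    Fintype.sum_equiv e _ _ hchar]

end AlmostConjugate

section Sunada

variable {n : ℕ} {Λ : AddSubgroup (E n)} {Γ : Subgroup (E n ≃ᵢ E n)} {μ : ℝ}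

theorem eigenspace_anti {Γ' : Subgroup (E n ≃ᵢ E n)} (h : Γ ≤ Γ') :
    eigenspace Γ' μ ≤ eigenspace Γ μ := fun _ hf => ⟨hf.1, fun g hg => hf.2.1 g (h hg), hf.2.2⟩

theorem apply_eq_of_mk_eq {f : E n → ℝ} (hf : f ∈ eigenspace (translGroup Λ) μ) {x y : E n}
    (hxy : (QuotientAddGroup.mk x : Torus Λ) = QuotientAddGroup.mk y) : f x = f y := by
  rw [← apply_add_of_mem_eigenspace hf (QuotientAddGroup.eq.1 hxy) x, add_neg_cancel_left]

theorem apply_out_eq_of_induces {f : E n → ℝ} (hf : f ∈ eigenspace (translGroup Λ) μ)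
    {g : E n ≃ᵢ E n} {h : Torus Λ ≃ᵢ Torus Λ} (hgh : Induces g h) (x : E n) :
    f (h (QuotientAddGroup.mk x)).out = f (g x) :=
  apply_eq_of_mk_eq hf ((QuotientAddGroup.out_eq' _).trans (hgh x))

theorem comp_mem_eigenspace_translGroup {f : E n → ℝ} (hf : f ∈ eigenspace (translGroup Λ) μ)
    {g : E n ≃ᵢ E n} {h : Torus Λ ≃ᵢ Torus Λ} (hgh : Induces g h) :
    (fun x => f (g x)) ∈ eigenspace (translGroup Λ) μ := by
  refine ⟨hf.1.comp (contDiff_isometryEquiv g), ?_, fun x => ?_⟩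
  · rintro _ ⟨v, hv, rfl⟩ x
    refine apply_eq_of_mk_eq hf ?_
    rw [← hgh, ← hgh, transl_apply, QuotientAddGroup.mk_add_of_mem x hv]
  · rw [laplacian_comp_isometryEquiv (contDiff_two_of_mem_eigenspace hf), hf.2.2]

/-- The representation `h ↦ (f ↦ f ∘ h⁻¹)` of the group of affine isometries of the torus on an
eigenspace of its Laplace operator; the functions on the torus are regarded as functions on `ℝⁿ`. -/
noncomputable def eigenspaceRep (Λ : AddSubgroup (E n)) (μ : ℝ) :
    Representation ℝ (inducedGroup Λ ⊤) (eigenspace (translGroup Λ) μ) where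
  toFun h :=
    { toFun f := ⟨fun x => f.1 (h⁻¹.1 (QuotientAddGroup.mk x)).out, by
        obtain ⟨g, -, hg⟩ := h⁻¹.2
        rw [funext (apply_out_eq_of_induces f.2 hg)]
        exact comp_mem_eigenspace_translGroup f.2 hg⟩
      map_add' _ _ := rfl
      map_smul' _ _ := rfl }
  map_one' := LinearMap.ext fun f => Subtype.ext <| funext fun x =>
    apply_eq_of_mk_eq f.2 (QuotientAddGroup.out_eq' _)
  map_mul' h k := LinearMap.ext fun f => Subtype.ext <| funext fun x => by
    apply apply_eq_of_mk_eq f.2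
    rw [QuotientAddGroup.out_eq', QuotientAddGroup.out_eq', QuotientAddGroup.out_eq', mul_inv_rev]
    rfl

theorem eigenspaceRep_apply {g : E n ≃ᵢ E n} {h : inducedGroup Λ ⊤} (hgh : Induces g h⁻¹.1)
    (f : eigenspace (translGroup Λ) μ) (x : E n) :
    (eigenspaceRep Λ μ h f).1 x = f.1 (g x) :=
  apply_out_eq_of_induces f.2 hgh x

variable {G : Subgroup (Torus Λ ≃ᵢ Torus Λ)}

theorem invariants_eigenspaceRep (hΓ : ∀ g ∈ Γ, ∃ h : Torus Λ ≃ᵢ Torus Λ, Induces g h)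
    (hG : G ≤ inducedGroup Λ ⊤) (hΓG : inducedGroup Λ Γ ≤ G) :
    Representation.invariants (((eigenspaceRep Λ μ).comp (Subgroup.inclusion hG)).comp
      ((inducedGroup Λ Γ).subgroupOf G).subtype) =
        (eigenspace Γ μ).comap (eigenspace (translGroup Λ) μ).subtype := by
  ext f
  constructor
  · refine fun hf => ⟨f.2.1, fun g hg x => ?_, f.2.2.2⟩
    obtain ⟨h, hgh⟩ := hΓ g hg
    have hmem : h⁻¹ ∈ inducedGroup Λ Γ := inv_mem ⟨g, hg, hgh⟩
    have hgh' : Induces g h⁻¹⁻¹ := by rwa [inv_inv]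
    have hfix := hf ⟨⟨h⁻¹, hΓG hmem⟩, hmem⟩
    exact (eigenspaceRep_apply (h := ⟨h⁻¹, hG (hΓG hmem)⟩) hgh' f x).symm.trans
      (congrFun (congrArg Subtype.val hfix) x)
  · rintro hf ⟨⟨h, hhG⟩, hh⟩
    obtain ⟨g, hg, hgh⟩ := (inducedGroup Λ Γ).inv_mem hh
    refine Subtype.ext (funext fun x => ?_)
    exact (eigenspaceRep_apply (h := ⟨h, hG hhG⟩) hgh f x).trans (hf.2.1 g hg x)

theorem finrank_eigenspace_eq (hΛ : translGroup Λ ≤ Γ)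
    (hΓ : ∀ g ∈ Γ, ∃ h : Torus Λ ≃ᵢ Torus Λ, Induces g h)
    (hG : G ≤ inducedGroup Λ ⊤) (hΓG : inducedGroup Λ Γ ≤ G) :
    Module.finrank ℝ (eigenspace Γ μ) =
      Module.finrank ℝ (Representation.invariants
        (((eigenspaceRep Λ μ).comp (Subgroup.inclusion hG)).comp
          ((inducedGroup Λ Γ).subgroupOf G).subtype)) := by
  rw [invariants_eigenspaceRep hΓ hG hΓG,
    (Submodule.comapSubtypeEquivOfLe (eigenspace_anti hΛ)).finrank_eq]

theorem isospectral_of_almostConjugate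
    [∀ μ, FiniteDimensional ℝ (eigenspace (translGroup Λ) μ)] {Γ₁ Γ₂ : Subgroup (E n ≃ᵢ E n)}
    (hΛ₁ : translGroup Λ ≤ Γ₁) (hΛ₂ : translGroup Λ ≤ Γ₂)
    (hΓ₁ : ∀ g ∈ Γ₁, ∃ h : Torus Λ ≃ᵢ Torus Λ, Induces g h)
    (hΓ₂ : ∀ g ∈ Γ₂, ∃ h : Torus Λ ≃ᵢ Torus Λ, Induces g h)
    (hG : G ≤ inducedGroup Λ ⊤) (hG₁ : inducedGroup Λ Γ₁ ≤ G) (hG₂ : inducedGroup Λ Γ₂ ≤ G)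
    (h : AlmostConjugate ((inducedGroup Λ Γ₁).subgroupOf G) ((inducedGroup Λ Γ₂).subgroupOf G)) :
    Isospectral Γ₁ Γ₂ := by
  refine fun μ => ⟨Submodule.finiteDimensional_of_le (eigenspace_anti hΛ₁),
    Submodule.finiteDimensional_of_le (eigenspace_anti hΛ₂), ?_⟩
  rw [finrank_eigenspace_eq hΛ₁ hΓ₁ hG hG₁, finrank_eigenspace_eq hΛ₂ hΓ₂ hG hG₂,
    h.finrank_invariants_eq]

end Sunada

theorem sunadaIsospectralVia_bigGroup :
    SunadaIsospectralVia bigGroup (inducedGroup Lam Gam₁) (inducedGroup Lam Gam₂) Gam₁ Gam₂ where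
  le₁ := inducedGroup_Gam₁_le
  le₂ := inducedGroup_Gam₂_le
  almostConjugate := almostConjugate_inducedGroup
  quotient₁ := isGlideGroup_Gam₁.orbifoldIsometric
  quotient₂ := isGlideGroup_Gam₂.orbifoldIsometric
  isospectral := isospectral_of_almostConjugate isGlideGroup_Gam₁.translGroup_le
    isGlideGroup_Gam₂.translGroup_le (fun _ => isGlideGroup_Gam₁.exists_induces)
    (fun _ => isGlideGroup_Gam₂.exists_induces) (bigGroup_le.trans (inducedGroup_mono le_top))
    inducedGroup_Gam₁_le inducedGroup_Gam₂_le almostConjugate_inducedGroup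

end FlatOrbifold

theorem mainTheorem9 :
    -- the two sets are groups, discrete and cocompact
    ((Gam₁ : Set (E 3 ≃ᵢ E 3)) = rhoSet trans₁ ∧ (Gam₂ : Set (E 3 ≃ᵢ E 3)) = rhoSet trans₂) ∧
    (IsCrystallographic Gam₁ ∧ IsCrystallographic Gam₂) ∧
    -- the orbifolds are not orientable
    (¬ Orientable Gam₁ ∧ ¬ Orientable Gam₂) ∧
    -- a common fundamental domain; the underlying space of the first orbifold
    (IsClosedFundamentalDomain Gam₁ box ∧ IsClosedFundamentalDomain Gam₂ box) ∧
    Nonempty (OrbitSpace Gam₁ ≃ₜ ProjectivePlane × Circle) ∧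
    -- the elements of the groups and the maps `B L_b` descend to the torus, and the induced groups
    -- consist of the classes of the `ρ_j`
    ((∀ g ∈ (Gam₁ : Set (E 3 ≃ᵢ E 3)) ∪ Gam₂ ∪ permSet,
        ∃ h : Torus Lam ≃ᵢ Torus Lam, Induces g h) ∧
      (inducedGroup Lam Gam₁ : Set (Torus Lam ≃ᵢ Torus Lam)) =
        {h | ∃ j, Induces (rho trans₁ j) h} ∧
      (inducedGroup Lam Gam₂ : Set (Torus Lam ≃ᵢ Torus Lam)) =
        {h | ∃ j, Induces (rho trans₂ j) h}) ∧
    -- Sunada isospectrality by means of the finite group `G`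
    (Finite bigGroup ∧
      SunadaIsospectralVia bigGroup (inducedGroup Lam Gam₁) (inducedGroup Lam Gam₂) Gam₁ Gam₂) ∧
    -- the orbifolds are not isometric
    ¬ OrbifoldIsometric Gam₁ Gam₂ ∧
    -- fixed points and isotropy
    (∀ Γ ∈ ({Gam₁, Gam₂} : Set (Subgroup (E 3 ≃ᵢ E 3))),
      {x : E 3 | ∃ g ∈ Γ, g ≠ 1 ∧ g x = x} = verticalLines ∧
      ∀ x ∈ verticalLines, (∃! g : E 3 ≃ᵢ E 3, g ∈ Γ ∧ g ≠ 1 ∧ g x = x) ∧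
        Nonempty (isotropy Γ x ≃* Multiplicative (ZMod 2))) ∧
    -- singular sets: two circles of length two, respectively four circles of length one
    (IsDisjointUnionOfCircles Gam₁ (singularSet Gam₁) 2 2 ∧
      IsDisjointUnionOfCircles Gam₂ (singularSet Gam₂) 4 1 ∧
      Nat.card (ConnectedComponents (singularSet Gam₁)) = 2 ∧
      Nat.card (ConnectedComponents (singularSet Gam₂)) = 4) :=
  ⟨⟨isGlideGroup_Gam₁.coe_eq_rhoSet trans₁_apply, isGlideGroup_Gam₂.coe_eq_rhoSet trans₂_apply⟩,
    ⟨isGlideGroup_Gam₁.isCrystallographic, isGlideGroup_Gam₂.isCrystallographic⟩,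
    ⟨isGlideGroup_Gam₁.not_orientable, isGlideGroup_Gam₂.not_orientable⟩,
    ⟨isGlideGroup_Gam₁.isClosedFundamentalDomain_box,
      isGlideGroup_Gam₂.isClosedFundamentalDomain_box⟩,
    nonempty_homeomorph_projectivePlane_prod_circle,
    ⟨fun _ hg => exists_induces_of_mem hg,
      coe_inducedGroup_eq (isGlideGroup_Gam₁.coe_eq_rhoSet trans₁_apply),
      coe_inducedGroup_eq (isGlideGroup_Gam₂.coe_eq_rhoSet trans₂_apply)⟩,
    ⟨finite_bigGroup, sunadaIsospectralVia_bigGroup⟩,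
    not_orbifoldIsometric_Gam₁_Gam₂,
    fun Γ hmem => by
      obtain ⟨c, hΓ⟩ : ∃ c, IsGlideGroup Γ c := by
        rcases hmem with rfl | rfl
        exacts [⟨_, isGlideGroup_Gam₁⟩, ⟨_, isGlideGroup_Gam₂⟩]
      exact ⟨hΓ.setOf_apply_eq, fun _ hx => ⟨hΓ.existsUnique_apply_eq hx,
        nonempty_isotropy_mulEquiv_zmod_two (hΓ.existsUnique_apply_eq hx)⟩⟩,
    ⟨isDisjointUnionOfCircles_Gam₁, isDisjointUnionOfCircles_Gam₂, card_components_Gam₁,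
      card_components_Gam₂⟩⟩
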